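/- **Categories.** - $\mathsf{AlgFrm}$: objects are algebraic frames, i.e. frames $L$ in which every element is a join of elements of the set $K(L)$ of compact elements; morphisms are frame homomorphisms (preserving arbitrary joins and finite meets, including the top $1$) that send compact elements to compact elements. - $\mathsf{DMS}_{\mathsf P}$: objects are distributive meet-semilattices, i.e. posets $M$ with all finite meets (in particular with a top, but not necessarily with a bottom) such that whenever $a\wedge b\le c$ there are $a'\ge a$, $b'\ge b$ with $a'\wedge b'=c$. Morphisms are the maps $\alpha:M_1\to M_2$ preserving finite meets (including the top) such that for every finite (possibly empty) $S\subseteq M_1$ and every upper bound $x$ of $\alpha[S]$ there is an upper bound $c$ of $S$ with $\alpha(c)\le x$. - $\mathsf{PGPS}_{\mathsf P}$: objects are pointed generalized Priestley spaces $\langle X,\tau,\le,X_0,m\rangle$: $\langle X,\tau,\le\rangle$ is a Priestley space (a compact ordered space in which $x\not\le y$ implies that some clopen upset contains $x$ and misses $y$); $m$ is the greatest element of $X$; $X_0\subseteq X\setminus\{m\}$ is dense in $X\setminus\{m\}$, and every $x\ne m$ lies below some $y\in X_0$; $x\in X_0$ iff $\mathcal I_x=\{U\in\mathcal A(X): x\notin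 U\}$ is nonempty and directed under inclusion; and $x\le y$ iff every $U\in\mathcal A(X)$ containing $x$ contains $y$. Here $\mathcal A(X)$ is the set of admissible clopen upsets: the clopen upsets $U$ for which all maximal elements of $X\setminus U$ lie in $X_0$. Morphisms are the strong Priestley morphisms $f:X\to Y$ (order-preserving, with $f^{-1}(U)\in\mathcal A(X)$ for all $U\in\mathcal A(Y)$) with $f[X_0]\subseteq Y_0$. **Functors.** A filter of $M$ is an upset closed under finite meets. It is prime if it is proper and $F_1\cap F_2\subseteq P$ implies $F_1\subseteq P$ or $F_2\subseteq P$ for all filters $F_1,F_2$. It is optimal if it is the restriction to $M$ of a prime filter of the distributive envelope of $M$, that is, of the lattice of finite (possibly empty) unions of the sets $\{P \text{ prime filter of } M: a\in P\}$, $a\in M$, into which $M$ is mapped by $a\mapsto\{P: a\in P\}$. An element $p\neq 1$ of $L$ is prime if $a\wedge b\le p$ implies $a\le p$ or $b\le p$; it is pseudoprime if $a_1\wedge\dots\wedge a_n\ll p$ implies $a_i\le p$ for some $i$, where $a\ll b$ means that $b\le\bigvee S$ implies $a\le\bigvee T$ for some finite $T\subseteq S$. Let $P(L)$ be the set of primes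 of $L$, and let $Y_L$ consist of the pseudoprimes of $L$ together with $1$, with the order of $L$ and the topology generated by the sets ${\uparrow}k\cap Y_L$, $k\in K(L)$, and their complements. Let $X_M$ be the set consisting of the optimal filters of $M$ and $M$ itself, ordered by inclusion, with the topology generated by the sets $\{F: a\in F\}$, $a\in M$, and their complements. A closed upset $C$ of $X$ is admissible if $X\setminus C={\downarrow}(X_0\setminus C)$. **Theorem.** 1. $\mathsf{AlgFrm}$ is equivalent to $\mathsf{DMS}_{\mathsf P}$ and dually equivalent to $\mathsf{PGPS}_{\mathsf P}$. More precisely (each functor being determined up to natural isomorphism by the description): - the functor $\mathcal F$ sending $M$ to the lattice of its filters ordered by inclusion, and $\alpha$ to $F\mapsto{\uparrow}\alpha[F]$, is an equivalence $\mathsf{DMS}_{\mathsf P}\to\mathsf{AlgFrm}$, with quasi-inverse the functor $\mathcal K$ sending $L$ to $K(L)$ with the dual order and $\alpha$ to its restriction; - the contravariant functor $\mathcal Y$ sending $L$ to $\langle Y_L, P(L), 1\rangle$ and $\alpha$ to the restriction of its right adjoint is a dual equivalence $\mathsf{AlgFrm}\to\mathsf{PGPS}_{\mathsf P}$, with quasi-inverse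 the functor $\mathcal V^a$ sending $X$ to its admissible closed upsets ordered by reverse inclusion and $f$ to $f^{-1}$; - the contravariant functor $\mathcal X$ sending $M$ to $\langle X_M,\{\text{prime filters}\},M\rangle$ and $\alpha$ to $\alpha^{-1}$ is a dual equivalence $\mathsf{DMS}_{\mathsf P}\to\mathsf{PGPS}_{\mathsf P}$, with quasi-inverse the functor $\mathcal A$ sending $X$ to $\mathcal A(X)$ ordered by inclusion and $f$ to $f^{-1}$; - $\mathcal X\cong\mathcal Y\circ\mathcal F$ and $\mathcal A\cong\mathcal K\circ\mathcal V^a$. 2. Let $L_1,L_2$ be algebraic frames, and let $\alpha:L_1\to L_2$ preserve arbitrary joins and compact elements, with right adjoint $r$. The following are equivalent: - (a) $\alpha$ is a frame homomorphism; - (b) $r(P(L_2))\subseteq P(L_1)$; - (c) $r$ restricts to a strong Priestley morphism $Y_{L_2}\to Y_{L_1}$, and $r(P(L_2))\subseteq P(L_1)$; - (d) for every finite $S\subseteq K(L_1)$ and every $k\in K(L_2)$ with $k\le\bigwedge\alpha[S]$ there is $c\in K(L_1)$ with $c\le\bigwedge S$ and $k\le\alpha(c)$. -/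

import Mathlib

open CategoryTheory Opposite OrderDual

universe u

/-! ### Algebraic frames -/

/-- An algebraic frame: a frame in which every element is a join of compact elements. -/
structure AlgFrm : Type (u + 1) where
  carrier : Type u
  [frame : Order.Frame carrier]
  [algebraic : IsCompactlyGenerated carrier]

namespace AlgFrm

instance : CoeSort AlgFrm.{u} (Type u) := ⟨AlgFrm.carrier⟩

attribute [instance] AlgFrm.frame AlgFrm.algebraic

/-- Morphisms of algebraic frames: frame homomorphisms (all joins, finite meets) that send
compact elements to compact elements. -/
@[ext]
structure Hom (L₁ L₂ : AlgFrm.{u}) : Type u where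
  toFrameHom : FrameHom L₁ L₂
  map_compact : ∀ k : L₁, IsCompactElement k → IsCompactElement (toFrameHom k)

instance : Category AlgFrm.{u} where
  Hom L₁ L₂ := Hom L₁ L₂
  id L := ⟨FrameHom.id L, fun _ hk => hk⟩
  comp f g := ⟨g.toFrameHom.comp f.toFrameHom,
    fun k hk => g.map_compact _ (f.map_compact k hk)⟩

/-- The underlying map of a morphism. -/
def fn {L₁ L₂ : AlgFrm.{u}} (f : L₁ ⟶ L₂) : L₁ → L₂ := (show Hom L₁ L₂ from f).toFrameHom

end AlgFrm

/-! ### Distributive meet-semilattices -/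

/-- A distributive meet-semilattice (with top, not necessarily with bottom). -/
structure DMSP : Type (u + 1) where
  carrier : Type u
  [semilattice : SemilatticeInf carrier]
  [top : OrderTop carrier]
  distrib : ∀ a b c : carrier, a ⊓ b ≤ c → ∃ a' b' : carrier, a ≤ a' ∧ b ≤ b' ∧ a' ⊓ b' = c

namespace DMSP

instance : CoeSort DMSP.{u} (Type u) := ⟨DMSP.carrier⟩

attribute [instance] DMSP.semilattice DMSP.top

/-- Morphisms of `DMSP`: maps preserving all finite meets such that every upper bound `x` of the
image of a finite set `S` (possibly empty) lies above the image of an upper bound of `S`. -/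
@[ext]
structure Hom (M₁ M₂ : DMSP.{u}) : Type u where
  toInfTopHom : InfTopHom M₁ M₂
  lift_upperBound : ∀ (S : Set M₁), S.Finite → ∀ x ∈ upperBounds (toInfTopHom '' S),
    ∃ c ∈ upperBounds S, toInfTopHom c ≤ x

instance : Category DMSP.{u} where
  Hom M₁ M₂ := Hom M₁ M₂
  id M := ⟨InfTopHom.id M, fun S _ x hx => ⟨x, fun s hs => hx ⟨s, hs, rfl⟩, le_rfl⟩⟩
  comp f g := ⟨g.toInfTopHom.comp f.toInfTopHom, fun S hS x hx => by
    obtain ⟨d, hd, hdx⟩ := g.lift_upperBound (f.toInfTopHom '' S) (hS.image _) x (by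
      rintro _ ⟨_, ⟨s, hs, rfl⟩, rfl⟩
      exact hx ⟨s, hs, rfl⟩)
    obtain ⟨c, hc, hcd⟩ := f.lift_upperBound S hS d hd
    exact ⟨c, hc, (OrderHomClass.mono g.toInfTopHom hcd).trans hdx⟩⟩

/-- The underlying map of a morphism. -/
def fn {M₁ M₂ : DMSP.{u}} (f : M₁ ⟶ M₂) : M₁ → M₂ := (show Hom M₁ M₂ from f).toInfTopHom

end DMSP

/-! ### Pointed generalized Priestley spaces -/

section Admissible

variable {X : Type u} [TopologicalSpace X] [PartialOrder X]

/-- Admissible clopen upsets, relative to a distinguished subset `X₀`: clopen upsets `U` such that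
all maximal elements of the complement of `U` belong to `X₀`. -/
def IsAdmissibleClopen (X₀ U : Set X) : Prop :=
  IsClopen U ∧ IsUpperSet U ∧ {x | Maximal (fun y => y ∉ U) x} ⊆ X₀

/-- Admissible closed upsets: closed upsets `C` whose complement is the downset generated by
`X₀ \ C`. -/
def IsAdmissibleClosed (X₀ C : Set X) : Prop :=
  IsClosed C ∧ IsUpperSet C ∧ Cᶜ = {x | ∃ y ∈ X₀ \ C, x ≤ y}

/-- The family of admissible clopen upsets that do not contain `x`. -/
def admissibleMissing (X₀ : Set X) (x : X) : Set (Set X) :=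
  {U | IsAdmissibleClopen X₀ U ∧ x ∉ U}

/-- Strong Priestley morphisms: order-preserving maps such that preimages of admissible clopen
upsets are admissible clopen upsets. -/
def IsStrongPriestley {Y : Type u} [TopologicalSpace Y] [PartialOrder Y]
    (X₀ : Set X) (Y₀ : Set Y) (f : X → Y) : Prop :=
  Monotone f ∧ ∀ U : Set Y, IsAdmissibleClopen Y₀ U → IsAdmissibleClopen X₀ (f ⁻¹' U)

end Admissible

/-- A pointed generalized Priestley space `⟨X, τ, ≤, X₀, m⟩`. -/
structure PGPSP : Type (u + 1) where
  carrier : Type u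
  [topology : TopologicalSpace carrier]
  [order : PartialOrder carrier]
  [compact : CompactSpace carrier]
  [priestley : PriestleySpace carrier]
  X₀ : Set carrier
  m : carrier
  le_m : ∀ x, x ≤ m
  X₀_subset : X₀ ⊆ {m}ᶜ
  X₀_dense : {m}ᶜ ⊆ closure X₀
  X₀_orderDense : ∀ x, x ≠ m → ∃ y ∈ X₀, x ≤ y
  mem_X₀_iff : ∀ x, x ∈ X₀ ↔
    (admissibleMissing X₀ x).Nonempty ∧ DirectedOn (· ⊆ ·) (admissibleMissing X₀ x)
  le_iff : ∀ x y, x ≤ y ↔ ∀ U, IsAdmissibleClopen X₀ U → x ∈ U → y ∈ U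

namespace PGPSP

instance : CoeSort PGPSP.{u} (Type u) := ⟨PGPSP.carrier⟩

attribute [instance] PGPSP.topology PGPSP.order PGPSP.compact PGPSP.priestley

/-- Morphisms of `PGPSP`: strong Priestley morphisms mapping `X₀` into `Y₀`. -/
@[ext]
structure Hom (X Y : PGPSP.{u}) : Type u where
  toFun : X → Y
  strong : IsStrongPriestley X.X₀ Y.X₀ toFun
  mapsTo : Set.MapsTo toFun X.X₀ Y.X₀

instance : Category PGPSP.{u} where
  Hom X Y := Hom X Y
  id X := ⟨fun x => x, ⟨fun _ _ h => h, fun _ hU => hU⟩, fun _ hx => hx⟩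
  comp f g := ⟨fun x => g.toFun (f.toFun x),
    ⟨fun _ _ h => g.strong.1 (f.strong.1 h), fun U hU => f.strong.2 _ (g.strong.2 U hU)⟩,
    fun _ hx => g.mapsTo (f.mapsTo hx)⟩

/-- The underlying map of a morphism. -/
def fn {X Y : PGPSP.{u}} (f : X ⟶ Y) : X → Y := (show Hom X Y from f).toFun

end PGPSP

/-! ### Prime and pseudoprime elements of a complete lattice; the space `Y_L` -/

section Pseudoprime

variable {L L' : Type u} [CompleteLattice L] [CompleteLattice L']

/-- The way below relation `a ≪ b`. -/
def WayBelow (a b : L) : Prop :=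
  ∀ S : Set L, b ≤ sSup S → ∃ T : Set L, T ⊆ S ∧ T.Finite ∧ a ≤ sSup T

/-- Pseudoprime elements: `p ≠ 1` and `a₁ ⊓ ⋯ ⊓ aₙ ≪ p` implies `aᵢ ≤ p` for some `i`.
(Prime elements are Mathlib's `InfPrime`.) -/
def IsPseudoprime (p : L) : Prop :=
  p ≠ ⊤ ∧ ∀ S : Finset L, WayBelow (S.inf id) p → ∃ a ∈ S, a ≤ p

/-- The topology on `L` with subbasis the sets `↑k` and their complements, `k` compact. -/
@[reducible]
def algebraicTopology (L : Type u) [CompleteLattice L] : TopologicalSpace L :=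
  TopologicalSpace.generateFrom
    ({U | ∃ k : L, IsCompactElement k ∧ U = Set.Ici k} ∪
      {U | ∃ k : L, IsCompactElement k ∧ U = (Set.Ici k)ᶜ})

/-- The set `Y_L` of pseudoprime elements together with the top element, ordered as in `L`. -/
abbrev YPoints (L : Type u) [CompleteLattice L] : Type u :=
  {p : L // IsPseudoprime p ∨ p = ⊤}

/-- `Y_L` carries the subspace topology. -/
instance YPoints.topology (L : Type u) [CompleteLattice L] : TopologicalSpace (YPoints L) :=
  TopologicalSpace.induced Subtype.val (algebraicTopology L)

/-- The prime elements of `L`, as a subset of `Y_L`. -/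
def YPoints.primes (L : Type u) [CompleteLattice L] : Set (YPoints L) := {p | InfPrime p.1}

/-- The right adjoint of a join-preserving map. -/
def rightAdjoint (α : L → L') (b : L') : L := sSup {a | α a ≤ b}

end Pseudoprime

/-! ### Prime and optimal filters of a meet-semilattice; the space `X_M` -/

section Filters

variable {M : Type u} [SemilatticeInf M] [OrderTop M]

/-- Prime filters: proper filters `P` such that `F₁ ∩ F₂ ⊆ P` implies `F₁ ⊆ P` or `F₂ ⊆ P`. -/
def IsPrimeFilter (P : Order.PFilter M) : Prop :=
  (P : Set M) ≠ Set.univ ∧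
    ∀ F₁ F₂ : Order.PFilter M, (F₁ : Set M) ∩ F₂ ⊆ P → F₁ ≤ P ∨ F₂ ≤ P

/-- The set of prime filters containing `a`. -/
def primeSet (a : M) : Set {P : Order.PFilter M // IsPrimeFilter P} := {P | a ∈ P.1}

theorem primeSet_inf (a b : M) : primeSet a ∩ primeSet b = primeSet (a ⊓ b) := by
  ext P
  exact Order.PFilter.inf_mem_iff.symm

/-- The distributive envelope of a distributive meet-semilattice `M`, constructed as the lattice
of finite unions (including the empty one) of sets `primeSet a`; `M` embeds into it by
`a ↦ primeSet a`. -/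
def distributiveEnvelope (M : Type u) [SemilatticeInf M] [OrderTop M] :
    Sublattice (Set {P : Order.PFilter M // IsPrimeFilter P}) where
  carrier := {A | ∃ S : Set M, S.Finite ∧ A = ⋃ a ∈ S, primeSet a}
  supClosed' := by
    rintro _ ⟨S, hS, rfl⟩ _ ⟨T, hT, rfl⟩
    exact ⟨S ∪ T, hS.union hT, by rw [Set.biUnion_union]; rfl⟩
  infClosed' := by
    rintro _ ⟨S, hS, rfl⟩ _ ⟨T, hT, rfl⟩
    refine ⟨Set.image2 (· ⊓ ·) S T, hS.image2 _ hT, ?_⟩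
    rw [Set.biUnion_image2]
    ext P
    simp only [← primeSet_inf, Set.inf_eq_inter, Set.mem_inter_iff, Set.mem_iUnion, exists_prop]
    constructor
    · rintro ⟨⟨a, ha, hP⟩, b, hb, hQ⟩
      exact ⟨a, ha, b, hb, hP, hQ⟩
    · rintro ⟨a, ha, b, hb, hP, hQ⟩
      exact ⟨⟨a, ha, hP⟩, b, hb, hQ⟩

/-- The embedding of `M` into its distributive envelope. -/
def toEnvelope (a : M) : distributiveEnvelope M :=
  ⟨primeSet a, {a}, Set.finite_singleton a, by simp⟩

/-- Optimal filters: restrictions to `M` of prime filters of the distributive envelope. -/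
def IsOptimalFilter (F : Order.PFilter M) : Prop :=
  ∃ P : Order.PFilter (distributiveEnvelope M), P.IsPrime ∧ (F : Set M) = toEnvelope ⁻¹' P

/-- The set `X_M` of optimal filters together with the improper filter, ordered by inclusion. -/
abbrev XPoints (M : Type u) [SemilatticeInf M] [OrderTop M] : Type u :=
  {F : Order.PFilter M // IsOptimalFilter F ∨ (F : Set M) = Set.univ}

/-- The topology of `X_M`, with subbasis the sets `{F | a ∈ F}` and their complements. -/
instance XPoints.topology (M : Type u) [SemilatticeInf M] [OrderTop M] :
    TopologicalSpace (XPoints M) :=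
  TopologicalSpace.generateFrom
    ({U | ∃ a : M, U = {F : XPoints M | a ∈ F.1}} ∪
      {U | ∃ a : M, U = {F : XPoints M | a ∈ F.1}ᶜ})

end Filters

/-! ### The functors, each described up to natural isomorphism -/

/-- `F` sends `M` to its lattice of filters ordered by inclusion and `α` to `G ↦ ↑α[G]`. -/
def IsFilterFunctor (F : DMSP.{u} ⥤ AlgFrm.{u}) : Prop :=
  ∃ e : ∀ M : DMSP.{u}, Order.PFilter M ≃o F.obj M,
    ∀ (M N : DMSP.{u}) (α : M ⟶ N) (G : Order.PFilter M),
      (((e N).symm (AlgFrm.fn (F.map α) (e M G)) : Order.PFilter N) : Set N) =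
        {y | ∃ x ∈ G, DMSP.fn α x ≤ y}

/-- `K` sends `L` to its compact elements with the dual order and `α` to its restriction. -/
def IsCompactElementsFunctor (K : AlgFrm.{u} ⥤ DMSP.{u}) : Prop :=
  ∃ e : ∀ L : AlgFrm.{u}, {k : L // IsCompactElement k}ᵒᵈ ≃o K.obj L,
    ∀ (L L' : AlgFrm.{u}) (α : L ⟶ L') (k : {k : L // IsCompactElement k}),
      (ofDual ((e L').symm (DMSP.fn (K.map α) (e L (toDual k))))).1 = AlgFrm.fn α k.1

/-- `Y` sends `L` to `⟨Y_L, P(L)⟩` and `α` to the restriction of its right adjoint. -/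
def IsPseudoprimeFunctor (Y : AlgFrm.{u}ᵒᵖ ⥤ PGPSP.{u}) : Prop :=
  ∃ e : ∀ L : AlgFrm.{u}, YPoints L ≃o Y.obj (op L),
    (∀ L, IsHomeomorph (e L) ∧ e L '' YPoints.primes L = (Y.obj (op L)).X₀) ∧
    ∀ (L L' : AlgFrm.{u}) (α : L ⟶ L') (p : YPoints L'),
      ((e L).symm (PGPSP.fn (Y.map α.op) (e L' p))).1 = rightAdjoint (AlgFrm.fn α) p.1

/-- `V` sends `X` to its admissible closed upsets ordered by reverse inclusion and `f` to the
preimage map. -/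
def IsAdmissibleClosedFunctor (V : PGPSP.{u}ᵒᵖ ⥤ AlgFrm.{u}) : Prop :=
  ∃ e : ∀ X : PGPSP.{u}, {C : Set X // IsAdmissibleClosed X.X₀ C}ᵒᵈ ≃o V.obj (op X),
    ∀ (X X' : PGPSP.{u}) (f : X ⟶ X') (C : {C : Set X' // IsAdmissibleClosed X'.X₀ C}),
      (ofDual ((e X).symm (AlgFrm.fn (V.map f.op) (e X' (toDual C))))).1 = PGPSP.fn f ⁻¹' C.1

/-- `A` sends `X` to its admissible clopen upsets ordered by inclusion and `f` to the preimage
map. -/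
def IsAdmissibleClopenFunctor (A : PGPSP.{u}ᵒᵖ ⥤ DMSP.{u}) : Prop :=
  ∃ e : ∀ X : PGPSP.{u}, {U : Set X // IsAdmissibleClopen X.X₀ U} ≃o A.obj (op X),
    ∀ (X X' : PGPSP.{u}) (f : X ⟶ X') (U : {U : Set X' // IsAdmissibleClopen X'.X₀ U}),
      ((e X).symm (DMSP.fn (A.map f.op) (e X' U))).1 = PGPSP.fn f ⁻¹' U.1

/-- `X` sends `M` to `⟨X_M, Pr(M)⟩` and `α` to the preimage map. -/
def IsOptimalFilterFunctor (X : DMSP.{u}ᵒᵖ ⥤ PGPSP.{u}) : Prop :=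
  ∃ e : ∀ M : DMSP.{u}, XPoints M ≃o X.obj (op M),
    (∀ M, IsHomeomorph (e M) ∧
      e M '' {F | IsPrimeFilter F.1} = (X.obj (op M)).X₀) ∧
    ∀ (M N : DMSP.{u}) (α : M ⟶ N) (F : XPoints N),
      (((e M).symm (PGPSP.fn (X.map α.op) (e N F))).1 : Set M) = DMSP.fn α ⁻¹' (F.1 : Set N)

/-!
Everything is recovered from compact elements. In the lattice of filters of a meet-semilattice the
compact elements are the principal filters, and an element of an algebraic frame is the directed
join of the compact elements below it; this gives `𝓕` and `𝓚`.

For the duality, Zorn's lemma separates the elements of an algebraic frame `L` by primes, so every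
`↑a ∩ Y_L` is an admissible closed upset. Conversely, an admissible closed upset `C` of `Y_L` is
`↑(⋀ C)`: a prime outside `C` cannot lie above `⋀ C`, because `C` is covered by finitely many clopen
sets `↑k` with `k` compact and not below the prime, and a prime above a finite meet lies above a
member. In the other direction, in the frame of admissible closed upsets of a space `X` the compact
elements are the admissible clopen upsets, and the pseudoprimes, together with the top, are the
principal upsets `↑x`; density of `X₀` makes each `↑x` with `x ≠ m` pseudoprime, and compactness
yields the converse.

A filter of `M` is optimal exactly when it is pseudoprime in the lattice of filters, because for a
pseudoprime filter `F` the filter of the envelope generated by `F` is disjoint from the ideal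
generated by `M \ F`, and the two can be separated by a prime filter. Hence `𝓧 ≅ 𝓨 ∘ 𝓕`.
-/

/-! ### Compact elements -/

section CompactElement

theorem isCompactElement_bot {α : Type*} [PartialOrder α] [OrderBot α] :
    IsCompactElement (⊥ : α) :=
  fun _ _ hs _ _ _ => ⟨hs.some, hs.some_mem, bot_le⟩

theorem isCompactElement_sup {α : Type*} [SemilatticeSup α] {a b : α} (ha : IsCompactElement a)
    (hb : IsCompactElement b) : IsCompactElement (a ⊔ b) := by
  intro s u hs hd hu hk
  obtain ⟨x, hx, hax⟩ := ha s u hs hd hu (le_sup_left.trans hk)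
  obtain ⟨y, hy, hby⟩ := hb s u hs hd hu (le_sup_right.trans hk)
  obtain ⟨z, hz, hxz, hyz⟩ := hd x hx y hy
  exact ⟨z, hz, sup_le (hax.trans hxz) (hby.trans hyz)⟩

theorem nonempty_isCompactElement_le {α : Type*} [PartialOrder α] [OrderBot α] (b : α) :
    {k : α | IsCompactElement k ∧ k ≤ b}.Nonempty :=
  ⟨⊥, isCompactElement_bot, bot_le⟩

theorem directedOn_isCompactElement_le {α : Type*} [SemilatticeSup α] (b : α) :
    DirectedOn (· ≤ ·) {k : α | IsCompactElement k ∧ k ≤ b} :=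
  fun x hx y hy =>
    ⟨x ⊔ y, ⟨isCompactElement_sup hx.1 hy.1, sup_le hx.2 hy.2⟩, le_sup_left, le_sup_right⟩

variable {α β : Type*} [CompleteLattice α] [IsCompactlyGenerated α] [CompleteLattice β]

theorem exists_isCompactElement_le_not_le {a b : α} (h : ¬ a ≤ b) :
    ∃ k : α, IsCompactElement k ∧ k ≤ a ∧ ¬ k ≤ b := by
  simpa using mt le_iff_compact_le_imp.2 h

theorem exists_isCompactElement_le_map {F : Type*} [FunLike F α β] [sSupHomClass F α β] (f : F)
    {a : α} {k : β} (hk : IsCompactElement k) (h : k ≤ f a) :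
    ∃ c : α, IsCompactElement c ∧ c ≤ a ∧ k ≤ f c := by
  rw [← sSup_compact_le_eq a, map_sSup] at h
  obtain ⟨_, ⟨c, ⟨hc, hca⟩, rfl⟩, hkc⟩ := hk _ _ ((nonempty_isCompactElement_le a).image f)
    ((directedOn_isCompactElement_le a).mono_comp fun _ _ h => OrderHomClass.mono f h)
    (isLUB_sSup _) h
  exact ⟨c, hc, hca, hkc⟩

theorem infPrime_iff_nonempty_directedOn {p : α} :
    InfPrime p ↔ {k : α | IsCompactElement k ∧ ¬ k ≤ p}.Nonempty ∧
      DirectedOn (· ≥ ·) {k : α | IsCompactElement k ∧ ¬ k ≤ p} := by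
  constructor
  · intro hp
    constructor
    · obtain ⟨k, hk, -, hkp⟩ := exists_isCompactElement_le_not_le (mt top_le_iff.1 hp.ne_top)
      exact ⟨k, hk, hkp⟩
    · rintro k ⟨-, hkp⟩ l ⟨-, hlp⟩
      obtain ⟨n, hn, hnkl, hnp⟩ :=
        exists_isCompactElement_le_not_le fun hkl => (hp.inf_le.1 hkl).elim hkp hlp
      exact ⟨n, ⟨hn, hnp⟩, hnkl.trans inf_le_left, hnkl.trans inf_le_right⟩
  · rintro ⟨⟨k, -, hkp⟩, hdir⟩
    refine ⟨fun hmax => hkp (hmax.eq_top ▸ le_top), fun a b hab => ?_⟩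
    by_contra! hne
    obtain ⟨k, hk, hka, hkp⟩ := exists_isCompactElement_le_not_le hne.1
    obtain ⟨l, hl, hlb, hlp⟩ := exists_isCompactElement_le_not_le hne.2
    obtain ⟨n, ⟨-, hnp⟩, hnk, hnl⟩ := hdir k ⟨hk, hkp⟩ l ⟨hl, hlp⟩
    exact hnp ((le_inf (le_trans hnk hka) (le_trans hnl hlb)).trans hab)

end CompactElement

theorem exists_infPrime_of_not_le {α : Type*} [Order.Frame α] [IsCompactlyGenerated α] {a b : α}
    (h : ¬ a ≤ b) : ∃ p : α, InfPrime p ∧ b ≤ p ∧ ¬ a ≤ p := by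
  obtain ⟨k, hk, hka, hkb⟩ := exists_isCompactElement_le_not_le h
  obtain ⟨p, hbp, hp⟩ := zorn_le_nonempty₀ {q : α | ¬ k ≤ q} (fun c hc hchain y hy => by
    refine ⟨sSup c, fun hkc => ?_, fun z => le_sSup⟩
    obtain ⟨x, hx, hkx⟩ := hk c _ ⟨y, hy⟩ hchain.directedOn (isLUB_sSup c) hkc
    exact hc hx hkx) b hkb
  have le_sup_of_not_le {e : α} (he : ¬ e ≤ p) : k ≤ p ⊔ e :=
    not_not.1 fun hk' => he (le_sup_right.trans (hp.2 hk' le_sup_left))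
  refine ⟨p, ⟨fun hmax => hp.1 (hmax.eq_top ▸ le_top), fun c d hcd => ?_⟩, hbp,
    fun hap => hp.1 (hka.trans hap)⟩
  by_contra! hne
  apply hp.1
  calc k ≤ (p ⊔ c) ⊓ (p ⊔ d) := le_inf (le_sup_of_not_le hne.1) (le_sup_of_not_le hne.2)
    _ = p ⊔ c ⊓ d := sup_inf_left .. |>.symm
    _ = p := sup_eq_left.2 hcd

/-! ### Pseudoprime elements -/

section Pseudoprime

variable {L : Type u} [CompleteLattice L] [IsCompactlyGenerated L]

theorem wayBelow_iff_exists_isCompactElement {a b : L} :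
    WayBelow a b ↔ ∃ k : L, IsCompactElement k ∧ a ≤ k ∧ k ≤ b := by
  constructor
  · intro h
    obtain ⟨T, hT, hfin, haT⟩ := h _ (sSup_compact_le_eq b).ge
    lift T to Finset L using hfin
    refine ⟨sSup T, ?_, haT, sSup_le fun x hx => (hT hx).2⟩
    rw [← Finset.sup_id_eq_sSup]
    exact CompleteLattice.isCompactElement_finsetSup T fun x hx => (hT hx).1
  · rintro ⟨k, hk, hak, hkb⟩ S hS
    obtain ⟨T, hTS, hkT⟩ :=
      (CompleteLattice.isCompactElement_iff_exists_le_sSup_of_le_sSup L k).1 hk S (hkb.trans hS)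
    exact ⟨T, hTS, T.finite_toSet, hak.trans (hkT.trans_eq (Finset.sup_id_eq_sSup T))⟩

theorem isPseudoprime_or_eq_top_iff {p : L} :
    (IsPseudoprime p ∨ p = ⊤) ↔ ∀ S : Finset L, S.Nonempty → (∀ s ∈ S, IsCompactElement s) →
      ∀ k : L, IsCompactElement k → S.inf id ≤ k → k ≤ p → ∃ s ∈ S, s ≤ p := by
  classical
  constructor
  · rintro (h | rfl) S hS - k hk hSk hkp
    · exact h.2 S (wayBelow_iff_exists_isCompactElement.2 ⟨k, hk, hSk, hkp⟩)
    · exact ⟨hS.choose, hS.choose_spec, le_top⟩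
  · intro h
    refine or_iff_not_imp_right.2 fun hp => ⟨hp, fun S hS => ?_⟩
    obtain ⟨k, hk, hSk, hkp⟩ := wayBelow_iff_exists_isCompactElement.1 hS
    have hSne : S.Nonempty := by
      rw [Finset.nonempty_iff_ne_empty]
      rintro rfl
      exact hp (top_le_iff.1 (hSk.trans hkp))
    by_contra! hne
    choose! f hfc hfle hfp using fun s hs => exists_isCompactElement_le_not_le (hne s hs)
    have hfS : (S.image f).inf id ≤ S.inf id := by
      rw [Finset.inf_image]
      exact Finset.inf_mono_fun hfle
    obtain ⟨t, ht, htp⟩ := h (S.image f) (hSne.image f) (Finset.forall_mem_image.2 hfc) k hk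
      (hfS.trans hSk) hkp
    obtain ⟨s, hs, rfl⟩ := Finset.mem_image.1 ht
    exact hfp s hs htp

theorem isPseudoprime_of_infPrime {p : L} (hp : InfPrime p) : IsPseudoprime p := by
  refine ⟨hp.ne_top, fun S hS => ?_⟩
  obtain ⟨k, -, hSk, hkp⟩ := wayBelow_iff_exists_isCompactElement.1 hS
  exact hp.finset_inf_le.1 (hSk.trans hkp)

end Pseudoprime

/-! ### Admissible sets in compact ordered spaces -/

section Preorder

variable {X : Type*} [TopologicalSpace X] [Preorder X]

theorem closedIciTopology_of_priestleySpace [PriestleySpace X] : ClosedIciTopology X where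
  isClosed_Ici _ := isOpen_compl_iff.1 <| isOpen_iff_forall_mem_open.2 fun _ hxy =>
    let ⟨U, hU, hup, hx, hy⟩ := exists_isClopen_upper_of_not_le hxy
    ⟨Uᶜ, fun _ hz hxz => hz (hup hxz hx), hU.compl.isOpen, hy⟩

theorem exists_le_maximal_of_isCompact [ClosedIciTopology X] {F : Set X} (hF : IsCompact F)
    {x : X} (hx : x ∈ F) : ∃ y, x ≤ y ∧ Maximal (· ∈ F) y := by
  refine zorn_le_nonempty₀ F (fun c hc hchain y hy => ?_) x hx
  have : Nonempty c := ⟨⟨y, hy⟩⟩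
  have hdir : Directed (· ⊇ ·) fun z : c => Set.Ici z.1 :=
    fun a b => (hchain.directed a b).imp fun _ => And.imp Set.Ici_subset_Ici.2 Set.Ici_subset_Ici.2
  obtain ⟨u, huF, hu⟩ : (F ∩ ⋂ z : c, Set.Ici z.1).Nonempty := by
    by_contra! hempty
    obtain ⟨z, hz⟩ := hF.elim_directed_family_closed _ (fun _ => isClosed_Ici)
      hempty hdir
    exact hz.subset ⟨hc z.2, le_rfl⟩
  exact ⟨u, huF, fun z hz => Set.mem_iInter.1 hu ⟨z, hz⟩⟩

end Preorder

section Admissible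

variable {X : Type u} [TopologicalSpace X] [PartialOrder X] {X₀ C D U V : Set X}

theorem isAdmissibleClosed_iff_exists_le :
    IsAdmissibleClosed X₀ C ↔
      IsClosed C ∧ IsUpperSet C ∧ ∀ x ∉ C, ∃ y ∈ X₀, y ∉ C ∧ x ≤ y := by
  refine and_congr_right fun _ => and_congr_right fun hC => ⟨fun h x hx => ?_, fun h => ?_⟩
  · obtain ⟨y, ⟨hy, hyC⟩, hxy⟩ := h.subset hx
    exact ⟨y, hy, hyC, hxy⟩
  · ext x
    refine ⟨fun hx => ?_, fun ⟨y, ⟨_, hyC⟩, hxy⟩ hx => hyC (hC hxy hx)⟩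
    obtain ⟨y, hy, hyC, hxy⟩ := h x hx
    exact ⟨y, ⟨hy, hyC⟩, hxy⟩

theorem IsAdmissibleClosed.exists_le (hC : IsAdmissibleClosed X₀ C) {x : X} (hx : x ∉ C) :
    ∃ y ∈ X₀, y ∉ C ∧ x ≤ y :=
  (isAdmissibleClosed_iff_exists_le.1 hC).2.2 x hx

theorem IsAdmissibleClosed.subset_iff (hD : IsAdmissibleClosed X₀ D) (hC : IsUpperSet C) :
    C ⊆ D ↔ ∀ y ∈ X₀, y ∈ C → y ∈ D := by
  refine ⟨fun h y _ hy => h hy, fun h x hx => ?_⟩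
  by_contra hxD
  obtain ⟨y, hy, hyD, hxy⟩ := hD.exists_le hxD
  exact hyD (h y hy (hC hxy hx))

theorem IsAdmissibleClosed.sInter {S : Set (Set X)} (h : ∀ C ∈ S, IsAdmissibleClosed X₀ C) :
    IsAdmissibleClosed X₀ (⋂₀ S) := by
  refine isAdmissibleClosed_iff_exists_le.2 ⟨isClosed_sInter fun C hC => (h C hC).1,
    isUpperSet_sInter fun C hC => (h C hC).2.1, fun x hx => ?_⟩
  obtain ⟨C, hCS, hxC⟩ : ∃ C ∈ S, x ∉ C := by simpa using hx
  obtain ⟨y, hy, hyC, hxy⟩ := (h C hCS).exists_le hxC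
  exact ⟨y, hy, fun hyS => hyC (hyS C hCS), hxy⟩

theorem IsAdmissibleClosed.inter (hC : IsAdmissibleClosed X₀ C) (hD : IsAdmissibleClosed X₀ D) :
    IsAdmissibleClosed X₀ (C ∩ D) := by
  rw [← Set.sInter_pair]
  exact .sInter (by rintro _ (rfl | rfl) <;> assumption)

theorem isAdmissibleClopen_iff [PriestleySpace X] [CompactSpace X] :
    IsAdmissibleClopen X₀ U ↔ IsAdmissibleClosed X₀ U ∧ IsOpen U := by
  have := closedIciTopology_of_priestleySpace (X := X)
  constructor
  · rintro ⟨hU, hup, hmax⟩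
    refine ⟨isAdmissibleClosed_iff_exists_le.2 ⟨hU.1, hup, fun x hx => ?_⟩, hU.2⟩
    obtain ⟨y, hxy, hy⟩ := exists_le_maximal_of_isCompact hU.2.isClosed_compl.isCompact hx
    exact ⟨y, hmax hy, hy.1, hxy⟩
  · rintro ⟨hU, ho⟩
    refine ⟨⟨hU.1, ho⟩, hU.2.1, fun x hx => ?_⟩
    obtain ⟨y, hy, hyU, hxy⟩ := hU.exists_le hx.1
    exact le_antisymm hxy (hx.2 hyU hxy) ▸ hy

theorem IsAdmissibleClopen.inter [PriestleySpace X] [CompactSpace X]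
    (hU : IsAdmissibleClopen X₀ U) (hV : IsAdmissibleClopen X₀ V) :
    IsAdmissibleClopen X₀ (U ∩ V) := by
  rw [isAdmissibleClopen_iff] at *
  exact ⟨hU.1.inter hV.1, hU.2.inter hV.2⟩

end Admissible

/-! ### Right adjoints -/

section RightAdjoint

variable {L L' : Type u} {F : Type*} [CompleteLattice L] [CompleteLattice L'] [FunLike F L L']

theorem gc_rightAdjoint [sSupHomClass F L L'] (f : F) : GaloisConnection f (rightAdjoint f) := by
  refine fun a b => ⟨fun h => le_sSup h, fun h => (OrderHomClass.mono f h).trans ?_⟩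
  rw [rightAdjoint, map_sSup]
  exact sSup_le (by rintro _ ⟨x, hx, rfl⟩; exact hx)

theorem rightAdjoint_id (a : L) : rightAdjoint id a = a := isLUB_Iic.sSup_eq

theorem rightAdjoint_comp {K : Type u} [CompleteLattice K] [sSupHomClass F L L'] (f : F)
    (g : K → L) (a : L') : rightAdjoint (f ∘ g) a = rightAdjoint g (rightAdjoint f a) :=
  congrArg sSup (Set.ext fun _ => gc_rightAdjoint f _ _)

theorem infPrime_rightAdjoint [FrameHomClass F L L'] (f : F) {p : L'} (hp : InfPrime p) :
    InfPrime (rightAdjoint f p) := by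
  refine ⟨fun hmax => hp.ne_top (top_le_iff.1 ?_), fun a b hab => ?_⟩
  · rw [← map_top f]
    exact (gc_rightAdjoint f _ _).2 hmax.eq_top.ge
  · rw [← gc_rightAdjoint f _ _, map_inf] at hab
    exact (hp.inf_le.1 hab).imp (gc_rightAdjoint f _ _).1 (gc_rightAdjoint f _ _).1

theorem isPseudoprime_rightAdjoint_or_eq_top [IsCompactlyGenerated L] [IsCompactlyGenerated L']
    [FrameHomClass F L L'] (f : F) (hf : ∀ k : L, IsCompactElement k → IsCompactElement (f k))
    {p : L'} (hp : IsPseudoprime p ∨ p = ⊤) :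
    IsPseudoprime (rightAdjoint f p) ∨ rightAdjoint f p = ⊤ := by
  classical
  refine isPseudoprime_or_eq_top_iff.2 fun S hS hc k hk hSk hkp => ?_
  have hfS : (S.image f).inf id ≤ f k := by
    rw [Finset.inf_image, Function.id_comp, ← Function.comp_id f, ← map_finset_inf]
    exact OrderHomClass.mono f hSk
  obtain ⟨t, ht, htp⟩ := isPseudoprime_or_eq_top_iff.1 hp (S.image f) (hS.image f)
    (Finset.forall_mem_image.2 fun s hs => hf s (hc s hs)) (f k) (hf k hk) hfS
    ((gc_rightAdjoint f _ _).2 hkp)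
  obtain ⟨s, hs, rfl⟩ := Finset.mem_image.1 ht
  exact ⟨s, hs, (gc_rightAdjoint f _ _).1 htp⟩

end RightAdjoint

/-! ### The space `Y_L` -/

namespace YPoints

variable {L L' : Type u}

section CompleteLattice

variable [CompleteLattice L]

theorem topology_eq : YPoints.topology L = TopologicalSpace.generateFrom
    ({U | ∃ k : L, IsCompactElement k ∧ U = {p : YPoints L | k ≤ p.1}} ∪
      {U | ∃ k : L, IsCompactElement k ∧ U = {p : YPoints L | k ≤ p.1}ᶜ}) := by
  rw [YPoints.topology, algebraicTopology, induced_generateFrom_eq, Set.image_union]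
  congr 2 <;> ext U <;> constructor
  all_goals first
    | rintro ⟨_, ⟨k, hk, rfl⟩, rfl⟩
      exact ⟨k, hk, rfl⟩
    | rintro ⟨k, hk, rfl⟩
      exact ⟨_, ⟨k, hk, rfl⟩, rfl⟩

/-- The set `↑a ∩ Y_L` of points of `Y_L` above `a`. -/
def up (a : L) : Set (YPoints L) := {p | a ≤ p.1}

theorem continuous_of_isClopen_preimage_up {X : Type*} [TopologicalSpace X] {f : X → YPoints L}
    (hf : ∀ k : L, IsCompactElement k → IsClopen (f ⁻¹' up k)) : Continuous f := by
  rw [topology_eq, continuous_generateFrom_iff]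
  rintro _ (⟨k, hk, rfl⟩ | ⟨k, hk, rfl⟩)
  · exact (hf k hk).isOpen
  · exact (hf k hk).compl.isOpen

theorem up_antitone : Antitone (up : L → Set (YPoints L)) := fun _ _ hab _ hp => hab.trans hp

theorem isUpperSet_up (a : L) : IsUpperSet (up a) := fun _ _ hpq hp => le_trans hp hpq

theorem up_sSup (s : Set L) : up (sSup s) = ⋂ a ∈ s, up a := by
  ext p
  simp [up]

theorem isClopen_up {k : L} (hk : IsCompactElement k) : IsClopen (up k) := by
  rw [IsClopen, ← isOpen_compl_iff, topology_eq]
  exact ⟨TopologicalSpace.isOpen_generateFrom_of_mem (Or.inr ⟨k, hk, rfl⟩),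
    TopologicalSpace.isOpen_generateFrom_of_mem (Or.inl ⟨k, hk, rfl⟩)⟩

theorem exists_isCompactElement_forall_mem_of_isOpen {p : YPoints L} {O : Set (YPoints L)}
    (hO : IsOpen O) (hp : p ∈ O) : ∃ (k : L) (T : Finset L), IsCompactElement k ∧ k ≤ p.1 ∧
      (∀ l ∈ T, IsCompactElement l ∧ ¬ l ≤ p.1) ∧
      ∀ q : YPoints L, k ≤ q.1 → (∀ l ∈ T, ¬ l ≤ q.1) → q ∈ O := by
  classical
  rw [topology_eq] at hO
  induction hO with
  | basic U hU =>
    obtain ⟨k, hk, rfl⟩ | ⟨k, hk, rfl⟩ := hU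
    · exact ⟨k, ∅, hk, hp, by simp, fun q hq _ => hq⟩
    · exact ⟨⊥, {k}, isCompactElement_bot, bot_le, by simpa using ⟨hk, hp⟩,
        fun q _ hq => hq k (Finset.mem_singleton_self k)⟩
  | univ => exact ⟨⊥, ∅, isCompactElement_bot, bot_le, by simp, fun _ _ _ => trivial⟩
  | inter U V _ _ ihU ihV =>
    obtain ⟨k, T, hk, hkp, hT, hU⟩ := ihU hp.1
    obtain ⟨l, S, hl, hlp, hS, hV⟩ := ihV hp.2
    refine ⟨k ⊔ l, T ∪ S, isCompactElement_sup hk hl, sup_le hkp hlp,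
      fun x hx => (Finset.mem_union.1 hx).elim (hT x) (hS x), fun q hq hTS => ?_⟩
    exact ⟨hU q (le_sup_left.trans hq) fun x hx => hTS x (Finset.mem_union_left _ hx),
      hV q (le_sup_right.trans hq) fun x hx => hTS x (Finset.mem_union_right _ hx)⟩
  | sUnion S _ ih =>
    obtain ⟨U, hU, hpU⟩ := hp
    obtain ⟨k, T, hk, hkp, hT, h⟩ := ih U hU hpU
    exact ⟨k, T, hk, hkp, hT, fun q hq hqT => ⟨U, hU, h q hq hqT⟩⟩

/-- The candidate limit in `L` of an ultrafilter on `Y_L`: the join of the compact elements `k`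
for which the ultrafilter contains `↑k ∩ Y_L`. -/
def ultrafilterLim (F : Ultrafilter (YPoints L)) : L := sSup {k | IsCompactElement k ∧ up k ∈ F}

theorem le_ultrafilterLim_iff (F : Ultrafilter (YPoints L)) {k : L} (hk : IsCompactElement k) :
    k ≤ ultrafilterLim F ↔ up k ∈ F := by
  refine ⟨fun h => ?_, fun h => le_sSup ⟨hk, h⟩⟩
  have hne : {k : L | IsCompactElement k ∧ up k ∈ F}.Nonempty :=
    ⟨⊥, isCompactElement_bot, Filter.mem_of_superset Filter.univ_mem fun p _ => bot_le⟩
  have hdir : DirectedOn (· ≤ ·) {k : L | IsCompactElement k ∧ up k ∈ F} := fun x hx y hy =>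
    ⟨x ⊔ y, ⟨isCompactElement_sup hx.1 hy.1,
      Filter.mem_of_superset (Filter.inter_mem hx.2 hy.2) fun p hp => sup_le hp.1 hp.2⟩,
      le_sup_left, le_sup_right⟩
  obtain ⟨l, hl, hkl⟩ := hk _ _ hne hdir (isLUB_sSup _) h
  exact Filter.mem_of_superset hl.2 (up_antitone hkl)

variable [IsCompactlyGenerated L]

theorem isPseudoprime_ultrafilterLim_or_eq_top (F : Ultrafilter (YPoints L)) :
    IsPseudoprime (ultrafilterLim F) ∨ ultrafilterLim F = ⊤ := by
  refine isPseudoprime_or_eq_top_iff.2 fun S hS hc k hk hSk hkF => ?_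
  have hcover : up k ⊆ ⋃ s ∈ (S : Set L), up s := fun p hp => by
    obtain ⟨s, hs, hsp⟩ := isPseudoprime_or_eq_top_iff.1 p.2 S hS hc k hk hSk hp
    exact Set.mem_biUnion hs hsp
  obtain ⟨s, hs, hsF⟩ := (Ultrafilter.finite_biUnion_mem_iff S.finite_toSet).1
    (Filter.mem_of_superset ((le_ultrafilterLim_iff F hk).1 hkF) hcover)
  exact ⟨s, hs, (le_ultrafilterLim_iff F (hc s hs)).2 hsF⟩

instance compactSpace : CompactSpace (YPoints L) := by
  refine ⟨isCompact_iff_ultrafilter_le_nhds.2 fun F _ =>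
    ⟨⟨ultrafilterLim F, isPseudoprime_ultrafilterLim_or_eq_top F⟩, Set.mem_univ _, ?_⟩⟩
  rw [topology_eq, TopologicalSpace.nhds_generateFrom]
  refine le_iInf₂ fun U hU => Filter.le_principal_iff.2 ?_
  obtain ⟨hpU, ⟨k, hk, rfl⟩ | ⟨k, hk, rfl⟩⟩ := hU
  · exact (le_ultrafilterLim_iff F hk).1 hpU
  · exact Ultrafilter.compl_mem_iff_notMem.2 fun h => hpU ((le_ultrafilterLim_iff F hk).2 h)

instance priestleySpace : PriestleySpace (YPoints L) := ⟨fun {p q} hpq => by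
  obtain ⟨k, hk, hkp, hkq⟩ := exists_isCompactElement_le_not_le hpq
  exact ⟨up k, isClopen_up hk, isUpperSet_up k, hkp, hkq⟩⟩

theorem isClosed_up (a : L) : IsClosed (up a) := by
  rw [← sSup_compact_le_eq a, up_sSup]
  exact isClosed_biInter fun k hk => (isClopen_up hk.1).1

theorem exists_eq_up_of_isAdmissibleClosed {C : Set (YPoints L)}
    (hC : IsAdmissibleClosed (primes L) C) : ∃ a : L, C = up a := by
  refine ⟨⨅ c ∈ C, c.1, Set.Subset.antisymm (fun c hc => iInf₂_le c hc) fun p hp => ?_⟩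
  by_contra hpC
  obtain ⟨q, hq, hqC, hpq⟩ := hC.exists_le hpC
  have hex (c : YPoints L) (hc : c ∈ C) : ∃ k : L, IsCompactElement k ∧ k ≤ c.1 ∧ ¬ k ≤ q.1 :=
    exists_isCompactElement_le_not_le fun hcq => hqC (hC.2.1 hcq hc)
  choose! k hk hkc hkq using hex
  obtain ⟨t, htC, hcover⟩ := hC.1.isCompact.elim_nhds_subcover (fun c => up (k c))
    fun c hc => (isClopen_up (hk c hc)).2.mem_nhds (hkc c hc)
  have hinf : t.inf k ≤ q.1 := by
    refine le_trans (le_iInf₂ fun c hc => ?_) (le_trans hp hpq)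
    obtain ⟨d, hd, hdc⟩ := Set.mem_iUnion₂.1 (hcover hc)
    exact (Finset.inf_le hd).trans hdc
  obtain ⟨c, hc, hcq⟩ := (InfPrime.finset_inf_le hq).1 hinf
  exact hkq c (htC c hc) hcq

theorem exists_eq_up_of_isAdmissibleClopen {U : Set (YPoints L)}
    (hU : IsAdmissibleClopen (primes L) U) : ∃ k : L, IsCompactElement k ∧ U = up k := by
  obtain ⟨hclosed, hopen⟩ := isAdmissibleClopen_iff.1 hU
  obtain ⟨a, rfl⟩ := exists_eq_up_of_isAdmissibleClosed hclosed
  have : Nonempty {k : L | IsCompactElement k ∧ k ≤ a} :=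
    (nonempty_isCompactElement_le a).to_subtype
  have hdir : Directed (· ⊇ ·) fun k : {k : L | IsCompactElement k ∧ k ≤ a} => up k.1 :=
    fun k l => ((directedOn_isCompactElement_le a).directed_val k l).imp fun _ h =>
      ⟨up_antitone h.1, up_antitone h.2⟩
  obtain ⟨⟨k, hk, hka⟩, hsub⟩ := exists_subset_nhds_of_compactSpace hdir
    (fun k => isClosed_up k.1) (U := up a) fun p hp => hopen.mem_nhds <|
      le_iff_compact_le_imp.2 fun k hk hka => Set.mem_iInter.1 hp ⟨k, hk, hka⟩
  exact ⟨k, hk, (up_antitone hka).antisymm hsub⟩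

end CompleteLattice

section Frame

variable [Order.Frame L] [IsCompactlyGenerated L]

theorem up_subset_up {a b : L} : up a ⊆ up b ↔ b ≤ a := by
  refine ⟨fun h => ?_, fun h => up_antitone h⟩
  by_contra hba
  obtain ⟨p, hp, hap, hbp⟩ := exists_infPrime_of_not_le hba
  exact hbp (h (show (⟨p, Or.inl (isPseudoprime_of_infPrime hp)⟩ : YPoints L) ∈ up a from hap))

theorem isAdmissibleClosed_up (a : L) : IsAdmissibleClosed (primes L) (up a) := by
  refine isAdmissibleClosed_iff_exists_le.2 ⟨isClosed_up a, isUpperSet_up a, fun p hp => ?_⟩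
  obtain ⟨q, hq, hpq, haq⟩ := exists_infPrime_of_not_le hp
  exact ⟨⟨q, Or.inl (isPseudoprime_of_infPrime hq)⟩, hq, haq, hpq⟩

theorem isAdmissibleClopen_up {k : L} (hk : IsCompactElement k) :
    IsAdmissibleClopen (primes L) (up k) :=
  isAdmissibleClopen_iff.2 ⟨isAdmissibleClosed_up k, (isClopen_up hk).2⟩

theorem admissibleMissing_primes_eq_image (p : YPoints L) :
    admissibleMissing (primes L) p = up '' {k | IsCompactElement k ∧ ¬ k ≤ p.1} := by
  ext U
  constructor
  · rintro ⟨hU, hpU⟩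
    obtain ⟨k, hk, rfl⟩ := exists_eq_up_of_isAdmissibleClopen hU
    exact ⟨k, ⟨hk, hpU⟩, rfl⟩
  · rintro ⟨k, ⟨hk, hkp⟩, rfl⟩
    exact ⟨isAdmissibleClopen_up hk, hkp⟩

theorem mem_primes_iff_admissibleMissing (p : YPoints L) :
    p ∈ primes L ↔ (admissibleMissing (primes L) p).Nonempty ∧
      DirectedOn (· ⊆ ·) (admissibleMissing (primes L) p) := by
  have hup : (up ⁻¹'o (· ⊆ ·) : L → L → Prop) = (· ≥ ·) := by
    ext a b
    exact up_subset_up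
  rw [admissibleMissing_primes_eq_image, Set.image_nonempty, directedOn_image, hup]
  exact infPrime_iff_nonempty_directedOn (p := p.1)

theorem exists_mem_primes_le {p : YPoints L} (hp : p.1 ≠ ⊤) : ∃ q ∈ primes L, p ≤ q := by
  obtain ⟨q, hq, hpq, -⟩ := exists_infPrime_of_not_le (mt top_le_iff.1 hp)
  exact ⟨⟨q, Or.inl (isPseudoprime_of_infPrime hq)⟩, hq, hpq⟩

theorem mem_closure_primes {p : YPoints L} (hp : p.1 ≠ ⊤) : p ∈ closure (primes L) := by
  refine mem_closure_iff.2 fun O hO hpO => ?_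
  obtain ⟨k, T, hk, hkp, hT, hsub⟩ := exists_isCompactElement_forall_mem_of_isOpen hO hpO
  have hTk : ¬ T.inf id ≤ k := by
    intro h
    obtain ⟨l, hl, hlp⟩ := (p.2.resolve_right hp).2 T
      (wayBelow_iff_exists_isCompactElement.2 ⟨k, hk, h, hkp⟩)
    exact (hT l hl).2 hlp
  obtain ⟨q, hq, hkq, hTq⟩ := exists_infPrime_of_not_le hTk
  exact ⟨⟨q, Or.inl (isPseudoprime_of_infPrime hq)⟩,
    hsub _ hkq fun l hl hlq => hTq ((Finset.inf_le hl).trans hlq), hq⟩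

theorem le_iff_forall_isAdmissibleClopen (p q : YPoints L) :
    p ≤ q ↔ ∀ U, IsAdmissibleClopen (primes L) U → p ∈ U → q ∈ U :=
  ⟨fun hpq _ hU hp => hU.2.1 hpq hp, fun h =>
    le_iff_compact_le_imp.2 fun _ hk hkp => h _ (isAdmissibleClopen_up hk) hkp⟩

end Frame

section Map

variable [CompleteLattice L] [IsCompactlyGenerated L]

/-- The restriction `Y_{L'} → Y_L` of the right adjoint of a frame homomorphism `L → L'` that
preserves compact elements. -/
def map [CompleteLattice L'] [IsCompactlyGenerated L'] (f : FrameHom L L')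
    (hf : ∀ k : L, IsCompactElement k → IsCompactElement (f k)) (p : YPoints L') : YPoints L :=
  ⟨rightAdjoint f p.1, isPseudoprime_rightAdjoint_or_eq_top f hf p.2⟩

theorem preimage_map_up [CompleteLattice L'] [IsCompactlyGenerated L'] (f : FrameHom L L')
    (hf : ∀ k : L, IsCompactElement k → IsCompactElement (f k)) (a : L) :
    map f hf ⁻¹' up a = up (f a) :=
  Set.ext fun _ => (gc_rightAdjoint f _ _).symm

theorem isStrongPriestley_map [Order.Frame L'] [IsCompactlyGenerated L'] (f : FrameHom L L')
    (hf : ∀ k : L, IsCompactElement k → IsCompactElement (f k)) :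
    IsStrongPriestley (primes L') (primes L) (map f hf) := by
  refine ⟨fun p q hpq => (gc_rightAdjoint f).monotone_u hpq, fun U hU => ?_⟩
  obtain ⟨k, hk, rfl⟩ := exists_eq_up_of_isAdmissibleClopen hU
  rw [preimage_map_up]
  exact isAdmissibleClopen_up (hf k hk)

end Map

/-- The pointed generalized Priestley space `⟨Y_L, P(L), 1⟩`. -/
def space (L : AlgFrm.{u}) : PGPSP.{u} where
  carrier := YPoints L
  X₀ := primes L
  m := ⟨⊤, Or.inr rfl⟩
  le_m _ := le_top (α := L)
  X₀_subset _ hp h := InfPrime.ne_top hp (congrArg Subtype.val h)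
  X₀_dense _ hp := mem_closure_primes fun h => hp (Subtype.ext h)
  X₀_orderDense _ hp := exists_mem_primes_le fun h => hp (Subtype.ext h)
  mem_X₀_iff := mem_primes_iff_admissibleMissing
  le_iff := le_iff_forall_isAdmissibleClopen

end YPoints

/-! ### Admissible upsets of a pointed generalized Priestley space -/

/-- The admissible hull of `C`: the points `x` such that every point of `X₀` above `x` is in `C`.
For a closed upset `C` of a pointed generalized Priestley space it is the least admissible closed
upset containing `C`. -/
def admissibleHull {X : Type*} [Preorder X] (X₀ C : Set X) : Set X := {x | ∀ y ∈ X₀, x ≤ y → y ∈ C}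

theorem subset_admissibleHull {X : Type*} [Preorder X] {X₀ C : Set X} (hC : IsUpperSet C) :
    C ⊆ admissibleHull X₀ C :=
  fun _ hx _ _ hxy => hC hxy hx

theorem mem_admissibleHull_iff {X : Type*} [Preorder X] {X₀ C : Set X} (hC : IsUpperSet C) {x : X}
    (hx : x ∈ X₀) : x ∈ admissibleHull X₀ C ↔ x ∈ C :=
  ⟨fun h => h x hx le_rfl, fun h => subset_admissibleHull hC h⟩

theorem IsAdmissibleClosed.admissibleHull_subset {X : Type u} [TopologicalSpace X] [PartialOrder X]
    {X₀ C D : Set X} (hD : IsAdmissibleClosed X₀ D) (hCD : C ⊆ D) : admissibleHull X₀ C ⊆ D := by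
  intro x hx
  by_contra hxD
  obtain ⟨y, hy, hyD, hxy⟩ := hD.exists_le hxD
  exact hyD (hCD (hx y hy hxy))

theorem isAdmissibleClopen_univ {X : Type u} [TopologicalSpace X] [PartialOrder X] {X₀ : Set X} :
    IsAdmissibleClopen X₀ Set.univ :=
  ⟨isClopen_univ, isUpperSet_univ, fun _ hx => absurd trivial hx.1⟩

namespace PGPSP

variable {X Y : PGPSP.{u}}

theorem exists_isAdmissibleClopen_forall_subset {ι : Type*} [Finite ι] {x : X} (hx : x ∈ X.X₀)
    {U : ι → Set X} (hU : ∀ i, IsAdmissibleClopen X.X₀ (U i)) (hxU : ∀ i, x ∉ U i) :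
    ∃ V, IsAdmissibleClopen X.X₀ V ∧ x ∉ V ∧ ∀ i, U i ⊆ V := by
  obtain ⟨hne, hdir⟩ := (X.mem_X₀_iff x).1 hx
  have := hne.to_subtype
  obtain ⟨⟨V, hV, hxV⟩, hUV⟩ := hdir.directed_val.finite_le fun i => ⟨U i, hU i, hxU i⟩
  exact ⟨V, hV, hxV, hUV⟩

theorem exists_isAdmissibleClopen_superset {C : Set X} (hC : IsClosed C) (hup : IsUpperSet C)
    {x : X} (hx : x ∈ X.X₀) (hxC : x ∉ C) :
    ∃ U, IsAdmissibleClopen X.X₀ U ∧ x ∉ U ∧ C ⊆ U := by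
  have hex (c : X) (hc : c ∈ C) : ∃ U, IsAdmissibleClopen X.X₀ U ∧ c ∈ U ∧ x ∉ U := by
    simpa using mt (X.le_iff c x).2 fun hcx => hxC (hup hcx hc)
  choose! U hU hcU hxU using hex
  obtain ⟨t, htC, hcover⟩ := hC.isCompact.elim_nhds_subcover U
    fun c hc => (hU c hc).1.2.mem_nhds (hcU c hc)
  obtain ⟨V, hV, hxV, hUV⟩ := exists_isAdmissibleClopen_forall_subset hx (U := fun c : t => U c)
    (fun c => hU c (htC c c.2)) fun c => hxU c (htC c c.2)
  exact ⟨V, hV, hxV, hcover.trans (Set.iUnion₂_subset fun c hc => hUV ⟨c, hc⟩)⟩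

theorem sInter_isAdmissibleClopen_superset {C : Set X} (hC : IsAdmissibleClosed X.X₀ C) :
    ⋂₀ {U | IsAdmissibleClopen X.X₀ U ∧ C ⊆ U} = C := by
  refine Set.Subset.antisymm (fun x hx => ?_) fun x hx U hU => hU.2 hx
  by_contra hxC
  obtain ⟨y, hy, hyC, hxy⟩ := hC.exists_le hxC
  obtain ⟨U, hU, hyU, hCU⟩ := exists_isAdmissibleClopen_superset hC.1 hC.2.1 hy hyC
  exact hyU (hU.2.1 hxy (hx U ⟨hU, hCU⟩))

theorem isAdmissibleClosed_sInter_isAdmissibleClopen {S : Set (Set X)}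
    (hS : ∀ U ∈ S, IsAdmissibleClopen X.X₀ U) : IsAdmissibleClosed X.X₀ (⋂₀ S) :=
  .sInter fun U hU => (isAdmissibleClopen_iff.1 (hS U hU)).1

theorem admissibleHull_eq_sInter {C : Set X} (hC : IsClosed C) (hup : IsUpperSet C) :
    admissibleHull X.X₀ C = ⋂₀ {U | IsAdmissibleClopen X.X₀ U ∧ C ⊆ U} := by
  refine Set.Subset.antisymm (Set.subset_sInter fun U hU =>
    (isAdmissibleClopen_iff.1 hU.1).1.admissibleHull_subset hU.2) fun x hx y hy hxy => ?_
  by_contra hyC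
  obtain ⟨U, hU, hyU, hCU⟩ := exists_isAdmissibleClopen_superset hC hup hy hyC
  exact hyU (hU.2.1 hxy (hx U ⟨hU, hCU⟩))

theorem isAdmissibleClosed_admissibleHull {C : Set X} (hC : IsClosed C) (hup : IsUpperSet C) :
    IsAdmissibleClosed X.X₀ (admissibleHull X.X₀ C) := by
  rw [admissibleHull_eq_sInter hC hup]
  exact isAdmissibleClosed_sInter_isAdmissibleClopen fun U hU => hU.1

theorem isAdmissibleClosed_Ici (x : X) : IsAdmissibleClosed X.X₀ (Set.Ici x) := by
  have hIci : Set.Ici x = ⋂₀ {U | IsAdmissibleClopen X.X₀ U ∧ x ∈ U} := by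
    ext y
    simp only [Set.mem_Ici, X.le_iff, Set.mem_sInter, Set.mem_ofPred_eq, and_imp]
  rw [hIci]
  exact isAdmissibleClosed_sInter_isAdmissibleClopen fun U hU => hU.1

theorem isAdmissibleClosed_preimage {f : X → Y} (hf : IsStrongPriestley X.X₀ Y.X₀ f) {C : Set Y}
    (hC : IsAdmissibleClosed Y.X₀ C) : IsAdmissibleClosed X.X₀ (f ⁻¹' C) := by
  rw [← sInter_isAdmissibleClopen_superset hC, Set.preimage_sInter, ← Set.sInter_image]
  exact isAdmissibleClosed_sInter_isAdmissibleClopen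
    (Set.forall_mem_image.2 fun U hU => hf.2 U hU.1)

/-! ### The frame of admissible closed upsets -/

/-- The admissible closed upsets of `X`, ordered by reverse inclusion. -/
abbrev ClosedUpsets (X : PGPSP.{u}) : Type u := {C : Set X // IsAdmissibleClosed X.X₀ C}ᵒᵈ

namespace ClosedUpsets

/-- The underlying set of an element of `ClosedUpsets X`. -/
def set (C : ClosedUpsets X) : Set X := (ofDual C).1

theorem isAdmissibleClosed_set (C : ClosedUpsets X) : IsAdmissibleClosed X.X₀ C.set := (ofDual C).2

theorem isClosed_set (C : ClosedUpsets X) : IsClosed C.set := C.isAdmissibleClosed_set.1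

theorem isUpperSet_set (C : ClosedUpsets X) : IsUpperSet C.set := C.isAdmissibleClosed_set.2.1

/-- The element of `ClosedUpsets X` given by an admissible closed upset. -/
def mk (C : Set X) (hC : IsAdmissibleClosed X.X₀ C) : ClosedUpsets X := toDual ⟨C, hC⟩

/-- The element of `ClosedUpsets X` given by an admissible clopen upset. -/
def ofClopen (U : Set X) (hU : IsAdmissibleClopen X.X₀ U) : ClosedUpsets X :=
  mk U (isAdmissibleClopen_iff.1 hU).1

theorem ext {C D : ClosedUpsets X} (h : C.set = D.set) : C = D := congrArg toDual (Subtype.ext h)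

theorem le_iff_forall_mem_X₀ {C D : ClosedUpsets X} :
    C ≤ D ↔ ∀ x ∈ X.X₀, x ∈ D.set → x ∈ C.set :=
  C.isAdmissibleClosed_set.subset_iff D.isUpperSet_set

instance : SupSet (ClosedUpsets X) :=
  ⟨fun S => mk (⋂₀ (set '' S))
    (.sInter (Set.forall_mem_image.2 fun C _ => C.isAdmissibleClosed_set))⟩

theorem set_sSup (S : Set (ClosedUpsets X)) : (sSup S).set = ⋂₀ (set '' S) := rfl

instance : CompleteLattice (ClosedUpsets X) where
  __ := completeLatticeOfSup (ClosedUpsets X) fun _ =>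
    ⟨fun C hC => Set.sInter_subset_of_mem ⟨C, hC, rfl⟩,
      fun _ hD => Set.subset_sInter (Set.forall_mem_image.2 fun _ hC => hD hC)⟩
  inf C D := mk (admissibleHull X.X₀ (C.set ∪ D.set))
    (isAdmissibleClosed_admissibleHull (C.isClosed_set.union D.isClosed_set)
      (C.isUpperSet_set.union D.isUpperSet_set))
  inf_le_left C D := Set.subset_union_left.trans
    (subset_admissibleHull (C.isUpperSet_set.union D.isUpperSet_set))
  inf_le_right C D := Set.subset_union_right.trans
    (subset_admissibleHull (C.isUpperSet_set.union D.isUpperSet_set))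
  le_inf E _ _ hC hD := E.isAdmissibleClosed_set.admissibleHull_subset (Set.union_subset hC hD)

theorem mem_set_inf {C D : ClosedUpsets X} {x : X} (hx : x ∈ X.X₀) :
    x ∈ (C ⊓ D).set ↔ x ∈ C.set ∨ x ∈ D.set :=
  mem_admissibleHull_iff (C.isUpperSet_set.union D.isUpperSet_set) hx

theorem m_mem_set (C : ClosedUpsets X) : X.m ∈ C.set := by
  by_contra hm
  obtain ⟨y, hy, -, hmy⟩ := C.isAdmissibleClosed_set.exists_le hm
  exact X.X₀_subset hy (le_antisymm (X.le_m y) hmy)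

theorem set_top : (⊤ : ClosedUpsets X).set = {X.m} := by
  refine Set.Subset.antisymm (fun x hx => ?_) (Set.singleton_subset_iff.2 (m_mem_set _))
  exact le_antisymm (X.le_m x) ((le_top : mk _ (isAdmissibleClosed_Ici X.m) ≤ ⊤) hx)

instance : Order.Frame (ClosedUpsets X) :=
  Order.Frame.ofMinimalAxioms
    { inf_sSup_le_iSup_inf := fun C S => by
        refine le_iff_forall_mem_X₀.2 fun x hx h => ?_
        rw [mem_set_inf hx, or_iff_not_imp_left, set_sSup]
        rintro hxC _ ⟨D, hD, rfl⟩
        have hle : C ⊓ D ≤ ⨆ b ∈ S, C ⊓ b := le_iSup₂_of_le D hD le_rfl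
        exact ((mem_set_inf hx).1 (hle h)).resolve_left hxC }

theorem exists_mem_set_subset_of_isOpen {S : Set (ClosedUpsets X)} (hne : S.Nonempty)
    (hdir : DirectedOn (· ≤ ·) S) {O : Set X} (hO : IsOpen O) (hS : (sSup S).set ⊆ O) :
    ∃ D ∈ S, D.set ⊆ O := by
  have := hne.to_subtype
  rw [set_sSup, Set.sInter_image, Set.biInter_eq_iInter] at hS
  obtain ⟨D, hD⟩ := exists_subset_nhds_of_compactSpace (V := fun D : S => D.1.set)
    hdir.directed_val (fun D => D.1.isClosed_set) fun x hx => hO.mem_nhds (hS hx)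
  exact ⟨D, D.2, hD⟩

theorem isCompactElement_of_isOpen {C : ClosedUpsets X} (hC : IsOpen C.set) :
    IsCompactElement C := by
  rw [CompleteLattice.isCompactElement_iff_le_of_directed_sSup_le]
  exact fun S hne hdir hle => exists_mem_set_subset_of_isOpen hne hdir hC hle

/-- The admissible clopen upsets containing `C`, as elements of `ClosedUpsets X`. -/
def clopens (C : ClosedUpsets X) : Set (ClosedUpsets X) :=
  {D | IsAdmissibleClopen X.X₀ D.set ∧ D ≤ C}

theorem sSup_clopens (C : ClosedUpsets X) : sSup C.clopens = C := by
  refine le_antisymm (sSup_le fun D hD => hD.2) fun x hx => ?_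
  exact (sInter_isAdmissibleClopen_superset C.isAdmissibleClosed_set).subset
    fun U hU => hx U ⟨ofClopen U hU.1, hU, rfl⟩

theorem directedOn_clopens (C : ClosedUpsets X) : DirectedOn (· ≤ ·) C.clopens :=
  fun _ hD _ hE => ⟨ofClopen _ (hD.1.inter hE.1),
    ⟨hD.1.inter hE.1, Set.subset_inter hD.2 hE.2⟩, Set.inter_subset_left, Set.inter_subset_right⟩

theorem nonempty_clopens (C : ClosedUpsets X) : C.clopens.Nonempty :=
  ⟨ofClopen _ isAdmissibleClopen_univ, isAdmissibleClopen_univ, Set.subset_univ _⟩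

theorem isCompactElement_iff {C : ClosedUpsets X} :
    IsCompactElement C ↔ IsAdmissibleClopen X.X₀ C.set := by
  refine ⟨fun h => ?_, fun h => isCompactElement_of_isOpen h.1.2⟩
  obtain ⟨D, hD, hCD⟩ := h _ _ C.nonempty_clopens C.directedOn_clopens (isLUB_sSup _)
    C.sSup_clopens.ge
  exact le_antisymm hCD hD.2 ▸ hD.1

instance : IsCompactlyGenerated (ClosedUpsets X) :=
  ⟨fun C => ⟨C.clopens, fun _ hD => isCompactElement_iff.2 hD.1, C.sSup_clopens⟩⟩

/-! ### Points of the space as pseudoprimes of the frame -/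

/-- The principal upset of a point, as an element of `ClosedUpsets X`. -/
def point (x : X) : ClosedUpsets X := mk (Set.Ici x) (isAdmissibleClosed_Ici x)

theorem le_point_iff {C : ClosedUpsets X} {x : X} : C ≤ point x ↔ x ∈ C.set :=
  ⟨fun h => h Set.self_mem_Ici, fun h _ hy => C.isUpperSet_set hy h⟩

theorem point_le_point_iff {x y : X} : point x ≤ point y ↔ x ≤ y := le_point_iff

theorem isPseudoprime_point_or_eq_top (x : X) : IsPseudoprime (point x) ∨ point x = ⊤ := by
  refine isPseudoprime_or_eq_top_iff.2 fun S hS hc K hK hSK hKx => ?_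
  simp only [isCompactElement_iff] at hc hK
  simp only [le_point_iff] at hKx ⊢
  by_contra! hno
  have hxm : x ≠ X.m := by
    rintro rfl
    exact hno _ hS.choose_spec (m_mem_set _)
  have hopen : IsOpen (K.set ∩ ⋂ D ∈ S, D.setᶜ) :=
    hK.1.2.inter (isOpen_biInter_finset fun D hD => (hc D hD).1.compl.2)
  obtain ⟨y, ⟨hyK, hyS⟩, hy⟩ := mem_closure_iff.1 (X.X₀_dense hxm) _ hopen
    ⟨hKx, Set.mem_iInter₂.2 hno⟩
  obtain ⟨U, hU, hyU, hSU⟩ := exists_isAdmissibleClopen_forall_subset hy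
    (U := fun D : S => D.1.set) (fun D => hc D D.2) fun D => Set.mem_iInter₂.1 hyS D D.2
  have hUS : ofClopen U hU ≤ S.inf id := Finset.le_inf fun D hD => hSU ⟨D, hD⟩
  exact hyU ((hUS.trans hSK) hyK)

theorem exists_mem_set_forall_le {C : ClosedUpsets X} (hC : IsPseudoprime C ∨ C = ⊤) :
    ∃ x ∈ C.set, ∀ U : ClosedUpsets X, IsCompactElement U → x ∈ U.set → U ≤ C := by
  classical
  by_contra! hno
  choose! U hU hxU hUC using hno
  have hopen (x : X) (hx : x ∈ C.set) : IsOpen (U x).set := (isCompactElement_iff.1 (hU x hx)).1.2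
  obtain ⟨t, htC, hcover⟩ := C.isClosed_set.isCompact.elim_nhds_subcover (fun x => (U x).set)
    fun x hx => (hopen x hx).mem_nhds (hxU x hx)
  have ht : t.Nonempty := by
    obtain ⟨x, hx, -⟩ := Set.mem_iUnion₂.1 (hcover C.m_mem_set)
    exact ⟨x, hx⟩
  obtain ⟨D, ⟨hD, hDC⟩, hDU⟩ := exists_mem_set_subset_of_isOpen C.nonempty_clopens
    C.directedOn_clopens (isOpen_biUnion fun x hx => hopen x (htC x hx))
    (C.sSup_clopens.symm ▸ hcover)
  have hinf : (t.image U).inf id ≤ D := fun x hx => by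
    obtain ⟨y, hy, hxy⟩ := Set.mem_iUnion₂.1 (hDU hx)
    exact (Finset.inf_le (f := id) (Finset.mem_image_of_mem U hy) : _ ≤ U y) hxy
  obtain ⟨V, hV, hVC⟩ := isPseudoprime_or_eq_top_iff.1 hC (t.image U) (ht.image U)
    (Finset.forall_mem_image.2 fun x hx => hU x (htC x hx)) D (isCompactElement_iff.2 hD) hinf hDC
  obtain ⟨x, hx, rfl⟩ := Finset.mem_image.1 hV
  exact hUC x (htC x hx) hVC

theorem exists_eq_point {C : ClosedUpsets X} (hC : IsPseudoprime C ∨ C = ⊤) :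
    ∃ x, C = point x := by
  obtain ⟨x, hxC, hx⟩ := exists_mem_set_forall_le hC
  exact ⟨x, le_antisymm (le_point_iff.2 hxC)
    (le_iff_compact_le_imp.2 fun U hU h => hx U hU (le_point_iff.1 h))⟩

theorem admissibleMissing_eq_image (x : X) :
    admissibleMissing X.X₀ x = set '' {U | IsCompactElement U ∧ ¬ U ≤ point x} := by
  ext U
  constructor
  · rintro ⟨hU, hxU⟩
    exact ⟨ofClopen U hU, ⟨isCompactElement_iff.2 hU, mt le_point_iff.1 hxU⟩, rfl⟩
  · rintro ⟨U, ⟨hU, hUx⟩, rfl⟩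
    exact ⟨isCompactElement_iff.1 hU, mt le_point_iff.2 hUx⟩

theorem infPrime_point_iff {x : X} : InfPrime (point x) ↔ x ∈ X.X₀ := by
  rw [X.mem_X₀_iff, admissibleMissing_eq_image, Set.image_nonempty, directedOn_image]
  exact infPrime_iff_nonempty_directedOn

/-! ### Preimages under morphisms -/

/-- The preimage map of a morphism, as a frame homomorphism. -/
def comap (f : Hom X Y) : FrameHom (ClosedUpsets Y) (ClosedUpsets X) where
  toFun C := mk (f.toFun ⁻¹' C.set) (isAdmissibleClosed_preimage f.strong C.isAdmissibleClosed_set)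
  map_inf' C D := by
    refine le_antisymm (le_iff_forall_mem_X₀.2 fun x hx h => ?_)
      (le_iff_forall_mem_X₀.2 fun x hx h => ?_)
    · exact (mem_set_inf (f.mapsTo hx)).2 ((mem_set_inf hx).1 h)
    · exact (mem_set_inf hx).2 ((mem_set_inf (f.mapsTo hx)).1 h)
  map_top' := by
    refine top_le_iff.1 (le_iff_forall_mem_X₀.2 fun x hx (h : f.toFun x ∈ set ⊤) => ?_)
    rw [set_top] at h
    exact absurd h (Y.X₀_subset (f.mapsTo hx))
  map_sSup' S := ext <| by
    change f.toFun ⁻¹' ⋂₀ (set '' S) = ⋂₀ (set '' (_ '' S))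
    rw [Set.preimage_sInter, Set.biInter_image, Set.sInter_image, Set.biInter_image]
    rfl

theorem isCompactElement_comap (f : Hom X Y) {C : ClosedUpsets Y} (hC : IsCompactElement C) :
    IsCompactElement (comap f C) :=
  isCompactElement_iff.2 (f.strong.2 _ (isCompactElement_iff.1 hC))

theorem rightAdjoint_comap_point (f : Hom X Y) (x : X) :
    rightAdjoint (comap f) (point x) = point (f.toFun x) :=
  eq_of_forall_le_iff fun C => by
    rw [← gc_rightAdjoint (comap f) C, le_point_iff, le_point_iff]
    rfl

end ClosedUpsets

end PGPSP

/-! ### Filters of a meet-semilattice -/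

section Filters

open Order (PFilter)
open Order.PFilter (principal principal_le_iff mem_of_le inf_mem top_mem)

section SemilatticeInf

variable {M : Type*} [SemilatticeInf M]

/-- The filter given by a nonempty upset that is closed under binary meets. -/
def pfilterOfInfClosed (s : Set M) (hne : s.Nonempty) (hinf : InfClosed s) (hup : IsUpperSet s) :
    PFilter M :=
  (Order.IsPFilter.of_def hne
    (fun _ hx _ hy => ⟨_, hinf hx hy, inf_le_left, inf_le_right⟩) fun h hx => hup h hx).toPFilter

theorem directedOn_principal_image (F : PFilter M) :
    DirectedOn (· ≤ ·) (principal '' (F : Set M)) := by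
  rintro _ ⟨x, hx, rfl⟩ _ ⟨y, hy, rfl⟩
  exact ⟨_, ⟨x ⊓ y, inf_mem hx hy, rfl⟩, PFilter.antitone_principal inf_le_left,
    PFilter.antitone_principal inf_le_right⟩

end SemilatticeInf

variable {M N K : Type*} [SemilatticeInf M] [OrderTop M] [SemilatticeInf N] [OrderTop N]
  [SemilatticeInf K] [OrderTop K]

instance : InfSet (PFilter M) := ⟨fun S => ⟨sInf (PFilter.dual '' S)⟩⟩

theorem mem_sInf_pfilter {S : Set (PFilter M)} {x : M} : x ∈ sInf S ↔ ∀ F ∈ S, x ∈ F :=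
  (Order.Ideal.mem_sInf (P := Mᵒᵈ)).trans Set.forall_mem_image

instance : CompleteLattice (PFilter M) where
  __ := completeLatticeOfInf (PFilter M) fun _ =>
    ⟨fun F hF _ hx => mem_sInf_pfilter.1 hx F hF,
      fun _ hG _ hx => mem_sInf_pfilter.2 fun _ hF => hG hF hx⟩
  __ := (inferInstance : OrderBot (PFilter M))

theorem mem_inf_pfilter {F G : PFilter M} {x : M} : x ∈ F ⊓ G ↔ x ∈ F ∧ x ∈ G := by
  simp only [← principal_le_iff, le_inf_iff]

theorem mem_top_pfilter {x : M} : x ∈ (⊤ : PFilter M) := principal_le_iff.1 le_top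

theorem pfilter_eq_top_iff {F : PFilter M} : F = ⊤ ↔ (F : Set M) = Set.univ := by
  rw [← top_le_iff, Set.eq_univ_iff_forall]
  exact ⟨fun h x => h mem_top_pfilter, fun h x _ => h x⟩

theorem sSup_principal_image (F : PFilter M) : sSup (principal '' (F : Set M)) = F :=
  le_antisymm (sSup_le (Set.forall_mem_image.2 fun _ hx => principal_le_iff.2 hx))
    fun _ hx => principal_le_iff.1 (le_sSup ⟨_, hx, rfl⟩)

theorem isCompactElement_principal (a : M) : IsCompactElement (principal a) := by
  rw [CompleteLattice.isCompactElement_iff_le_of_directed_sSup_le]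
  intro S hne hdir ha
  let union : PFilter M := pfilterOfInfClosed {x | ∃ F ∈ S, x ∈ F}
    ⟨⊤, hne.some, hne.some_mem, top_mem⟩
    (fun x ⟨F, hF, hx⟩ y ⟨G, hG, hy⟩ => by
      obtain ⟨H, hH, hFH, hGH⟩ := hdir F hF G hG
      exact ⟨H, hH, inf_mem (hFH hx) (hGH hy)⟩)
    (fun x y hxy ⟨F, hF, hx⟩ => ⟨F, hF, mem_of_le hxy hx⟩)
  have hle : sSup S ≤ union := sSup_le fun F hF x hx => ⟨F, hF, hx⟩
  obtain ⟨F, hF, haF⟩ := hle (principal_le_iff.1 ha)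
  exact ⟨F, hF, principal_le_iff.2 haF⟩

theorem isCompactElement_pfilter_iff {F : PFilter M} :
    IsCompactElement F ↔ ∃ a, F = principal a := by
  refine ⟨fun h => ?_, fun ⟨a, ha⟩ => ha ▸ isCompactElement_principal a⟩
  obtain ⟨_, ⟨a, ha, rfl⟩, hFa⟩ := h _ _ (F.nonempty.image principal)
    (directedOn_principal_image F) (isLUB_sSup _) (sSup_principal_image F).ge
  exact ⟨a, le_antisymm hFa (principal_le_iff.2 ha)⟩

instance : IsCompactlyGenerated (PFilter M) :=
  ⟨fun F => ⟨_, Set.forall_mem_image.2 fun x _ => isCompactElement_principal x,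
    sSup_principal_image F⟩⟩

/-- The filter `↑α[F]` generated by the image of a filter `F` under `α`. -/
def mapFilter (α : InfTopHom M N) (F : PFilter M) : PFilter N :=
  pfilterOfInfClosed {y | ∃ x ∈ F, α x ≤ y} ⟨⊤, ⊤, top_mem, le_top⟩
    (fun _ ⟨x, hx, hxy⟩ _ ⟨x', hx', hxy'⟩ =>
      ⟨x ⊓ x', inf_mem hx hx', (map_inf α x x').trans_le (inf_le_inf hxy hxy')⟩)
    (fun _ _ hyz ⟨x, hx, hxy⟩ => ⟨x, hx, hxy.trans hyz⟩)

/-- The preimage of a filter under `α`. -/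
def comapFilter (α : InfTopHom M N) (G : PFilter N) : PFilter M :=
  pfilterOfInfClosed (α ⁻¹' G) ⟨⊤, by simp⟩
    (fun x hx y hy => by
      rw [Set.mem_preimage, map_inf]
      exact inf_mem (F := G) hx hy)
    (fun _ _ hxy hx => mem_of_le (OrderHomClass.mono α hxy) hx)

theorem gc_mapFilter_comapFilter (α : InfTopHom M N) :
    GaloisConnection (mapFilter α) (comapFilter α) :=
  fun _ _ => ⟨fun h x hx => h ⟨x, hx, le_rfl⟩, fun h _ ⟨_, hx, hxy⟩ => mem_of_le hxy (h hx)⟩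

theorem mapFilter_principal (α : InfTopHom M N) (a : M) :
    mapFilter α (principal a) = principal (α a) :=
  eq_of_forall_ge_iff fun G => by
    rw [gc_mapFilter_comapFilter α, principal_le_iff, principal_le_iff]
    rfl

theorem mapFilter_id (F : PFilter M) : mapFilter (InfTopHom.id M) F = F :=
  PFilter.ext _ _ <| Set.ext fun x => ⟨fun ⟨_, hy, hyx⟩ => mem_of_le hyx hy,
    fun hx => ⟨x, hx, le_rfl⟩⟩

theorem mapFilter_comp (α : InfTopHom M N) (β : InfTopHom N K) (F : PFilter M) :
    mapFilter (β.comp α) F = mapFilter β (mapFilter α F) :=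
  PFilter.ext _ _ <| Set.ext fun _ => ⟨fun ⟨x, hx, hxz⟩ => ⟨_, ⟨x, hx, le_rfl⟩, hxz⟩,
    fun ⟨_, ⟨x, hx, hxy⟩, hyz⟩ => ⟨x, hx, (OrderHomClass.mono β hxy).trans hyz⟩⟩

namespace DMSP

variable {M N : DMSP.{u}}

/-- The relative pseudocomplement in the lattice of filters of a distributive meet-semilattice. -/
def filterHimp (F G : PFilter M) : PFilter M :=
  pfilterOfInfClosed {x | ∀ y, x ≤ y → y ∈ F → y ∈ G} ⟨⊤, fun _ hy _ => top_le_iff.1 hy ▸ top_mem⟩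
    (fun x hx x' hx' y hy hyF => by
      obtain ⟨a, b, hxa, hxb, rfl⟩ := M.distrib x x' y hy
      exact inf_mem (hx a hxa (mem_of_le inf_le_left hyF)) (hx' b hxb (mem_of_le inf_le_right hyF)))
    (fun _ _ hxx' hx y hy => hx y (hxx'.trans hy))

theorem le_filterHimp_iff (F G H : PFilter M) : F ≤ filterHimp G H ↔ F ⊓ G ≤ H :=
  ⟨fun h x hx => h (mem_inf_pfilter.1 hx).1 x le_rfl (mem_inf_pfilter.1 hx).2,
    fun h _ hx _ hxy hy => h (mem_inf_pfilter.2 ⟨mem_of_le hxy hx, hy⟩)⟩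

instance : Order.Frame (PFilter M) :=
  Order.Frame.ofMinimalAxioms
    { inf_sSup_le_iSup_inf := fun F S => by
        rw [inf_comm, ← le_filterHimp_iff]
        refine sSup_le fun G hG => ?_
        rw [le_filterHimp_iff, inf_comm]
        exact le_iSup₂_of_le G hG le_rfl }

/-- The algebraic frame of filters of a distributive meet-semilattice. -/
def filterFrame (M : DMSP.{u}) : AlgFrm.{u} where
  carrier := PFilter M

/-- The map `F ↦ ↑α[F]` of filter lattices induced by a morphism `α`, as a frame homomorphism. -/
def mapFilterHom (α : Hom M N) : FrameHom (PFilter M) (PFilter N) where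
  toFun := mapFilter α.toInfTopHom
  map_inf' F G := by
    refine le_antisymm ((gc_mapFilter_comapFilter _).monotone_l.map_inf_le F G) fun y hy => ?_
    obtain ⟨⟨x, hx, hxy⟩, ⟨x', hx', hxy'⟩⟩ := mem_inf_pfilter.1 hy
    obtain ⟨c, hc, hcy⟩ := α.lift_upperBound {x, x'} (Set.toFinite _) y (by
      rintro _ ⟨z, rfl | rfl, rfl⟩ <;> assumption)
    have hcF : c ∈ F := mem_of_le (hc (Set.mem_insert x {x'})) hx
    have hcG : c ∈ G := mem_of_le (hc (Set.mem_insert_of_mem x rfl)) hx'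
    exact ⟨c, mem_inf_pfilter.2 ⟨hcF, hcG⟩, hcy⟩
  map_top' := top_le_iff.1 fun y _ => by
    obtain ⟨c, -, hc⟩ := α.lift_upperBound ∅ Set.finite_empty y (by simp)
    exact ⟨c, mem_top_pfilter, hc⟩
  map_sSup' S := (gc_mapFilter_comapFilter _).l_sSup.trans sSup_image.symm

theorem isCompactElement_mapFilterHom (α : Hom M N) {F : PFilter M} (hF : IsCompactElement F) :
    IsCompactElement (mapFilterHom α F) := by
  obtain ⟨a, rfl⟩ := isCompactElement_pfilter_iff.1 hF
  exact isCompactElement_pfilter_iff.2 ⟨_, mapFilter_principal α.toInfTopHom a⟩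

/-- The morphism of filter frames induced by a morphism of distributive meet-semilattices. -/
def mapFilterFrame (α : Hom M N) : AlgFrm.Hom M.filterFrame N.filterFrame :=
  ⟨mapFilterHom α, fun _ => isCompactElement_mapFilterHom α⟩

end DMSP

end Filters

/-- The functor `𝓕` from distributive meet-semilattices to algebraic frames. -/
def filterFunctor : DMSP.{u} ⥤ AlgFrm.{u} where
  obj M := M.filterFrame
  map α := DMSP.mapFilterFrame α
  map_id _ := AlgFrm.Hom.ext (FrameHom.ext mapFilter_id)
  map_comp α β := AlgFrm.Hom.ext (FrameHom.ext
    (mapFilter_comp (DMSP.Hom.toInfTopHom α) (DMSP.Hom.toInfTopHom β)))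

/-! ### The semilattice of compact elements -/

/-- The compact elements of `L`, in the order of `L`. The semilattice `K(L)` is the order dual. -/
abbrev CompactElements (L : Type*) [PartialOrder L] : Type _ := {k : L // IsCompactElement k}

instance {L : Type*} [SemilatticeSup L] : SemilatticeSup (CompactElements L) :=
  Subtype.semilatticeSup fun _ _ => isCompactElement_sup

instance {L : Type*} [PartialOrder L] [OrderBot L] : OrderBot (CompactElements L) :=
  Subtype.orderBot isCompactElement_bot

theorem exists_isCompactElement_le_sup {L : Type*} [CompleteLattice L] [IsCompactlyGenerated L]
    {a b c : L} (hc : IsCompactElement c) (h : c ≤ a ⊔ b) :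
    ∃ k : L, IsCompactElement k ∧ k ≤ a ∧ c ≤ k ⊔ b := by
  have hsup : a ⊔ b ≤ sSup ((· ⊔ b) '' {k : L | IsCompactElement k ∧ k ≤ a}) := by
    refine sup_le (le_iff_compact_le_imp.2 fun k hk hka => ?_) ?_
    · exact le_sSup_of_le ⟨k, ⟨hk, hka⟩, rfl⟩ le_sup_left
    · exact le_sSup_of_le ⟨⊥, ⟨isCompactElement_bot, bot_le⟩, rfl⟩ le_sup_right
  obtain ⟨_, ⟨k, ⟨hk, hka⟩, rfl⟩, hck⟩ := hc _ _ ((nonempty_isCompactElement_le a).image _)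
    ((directedOn_isCompactElement_le a).mono_comp fun _ _ hkl => sup_le_sup_right hkl b)
    (isLUB_sSup _) (h.trans hsup)
  exact ⟨k, hk, hka, hck⟩

theorem exists_isCompactElement_sup_eq {L : Type*} [Order.Frame L] [IsCompactlyGenerated L]
    {a b c : L} (hc : IsCompactElement c) (h : c ≤ a ⊔ b) :
    ∃ k l : L, IsCompactElement k ∧ IsCompactElement l ∧ k ≤ a ∧ l ≤ b ∧ k ⊔ l = c := by
  have hc' : c ≤ c ⊓ b ⊔ c ⊓ a := by
    rw [← inf_sup_left, sup_comm]
    exact le_inf le_rfl h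
  obtain ⟨l, hl, hlb, hcl⟩ := exists_isCompactElement_le_sup hc hc'
  obtain ⟨k, hk, hka, hck⟩ := exists_isCompactElement_le_sup hc (hcl.trans (sup_comm _ _).le)
  exact ⟨k, l, hk, hl, hka.trans inf_le_right, hlb.trans inf_le_right,
    le_antisymm (sup_le (hka.trans inf_le_left) (hlb.trans inf_le_left)) hck⟩

theorem exists_isCompactElement_mem_lowerBounds {L L' : Type*} [CompleteLattice L]
    [IsCompactlyGenerated L] [CompleteLattice L'] {F : Type*} [FunLike F L L']
    [FrameHomClass F L L'] (f : F) {S : Set L} (hS : S.Finite) {k : L'} (hk : IsCompactElement k)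
    (h : ∀ s ∈ S, k ≤ f s) : ∃ c ∈ lowerBounds S, IsCompactElement c ∧ k ≤ f c := by
  have hkS : k ≤ f (hS.toFinset.inf id) := by
    rw [map_finset_inf]
    exact Finset.le_inf fun s hs => h s (hS.mem_toFinset.1 hs)
  obtain ⟨c, hc, hcS, hkc⟩ := exists_isCompactElement_le_map f hk hkS
  exact ⟨c, fun s hs => hcS.trans (Finset.inf_le (f := id) (hS.mem_toFinset.2 hs)), hc, hkc⟩

namespace AlgFrm

/-- The distributive meet-semilattice `K(L)` of compact elements with the dual order. -/
def compactDMSP (L : AlgFrm.{u}) : DMSP.{u} where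
  carrier := (CompactElements L)ᵒᵈ
  distrib _ _ c h := by
    obtain ⟨k, l, hk, hl, hka, hlb, hkl⟩ := exists_isCompactElement_sup_eq (ofDual c).2 h
    exact ⟨toDual ⟨k, hk⟩, toDual ⟨l, hl⟩, hka, hlb, congrArg toDual (Subtype.ext hkl)⟩

variable {L L' : AlgFrm.{u}}

/-- The restriction of a morphism of algebraic frames to compact elements. -/
def compactMap (f : Hom L L') : DMSP.Hom L.compactDMSP L'.compactDMSP where
  toInfTopHom :=
    { toFun := fun k : (CompactElements L)ᵒᵈ => (toDual
        ⟨f.toFrameHom (ofDual k).1, f.map_compact _ (ofDual k).2⟩ : (CompactElements L')ᵒᵈ)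
      map_inf' := fun (k l : (CompactElements L)ᵒᵈ) =>
        congrArg toDual (Subtype.ext (map_sup f.toFrameHom (ofDual k).1 (ofDual l).1))
      map_top' := congrArg toDual (Subtype.ext (map_bot f.toFrameHom)) }
  lift_upperBound S hS x hx := by
    obtain ⟨c, hcS, hc, hxc⟩ := exists_isCompactElement_mem_lowerBounds f.toFrameHom
      (hS.image fun s : (CompactElements L)ᵒᵈ => (ofDual s).1) (ofDual x).2
      (Set.forall_mem_image.2 fun s hs => hx ⟨s, hs, rfl⟩)
    exact ⟨toDual ⟨c, hc⟩, fun s hs => hcS ⟨s, hs, rfl⟩, hxc⟩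

end AlgFrm

/-- The functor `𝓚` from algebraic frames to distributive meet-semilattices. -/
def compactFunctor : AlgFrm.{u} ⥤ DMSP.{u} where
  obj L := L.compactDMSP
  map f := AlgFrm.compactMap f
  map_id _ := rfl
  map_comp _ _ := rfl

/-! ### The equivalence of semilattices and frames -/

theorem isCompactElement_map_orderIso {α β : Type*} [PartialOrder α] [PartialOrder β]
    (e : α ≃o β) {k : α} (hk : IsCompactElement k) : IsCompactElement (e k) := by
  intro s u hs hdir hu hku
  obtain ⟨_, ⟨x, hx, rfl⟩, hkx⟩ := hk (e.symm '' s) (e.symm u) (hs.image _)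
    (hdir.mono_comp fun _ _ h => e.symm.monotone h) (e.symm.isLUB_image'.2 hu)
    (e.le_symm_apply.2 hku)
  exact ⟨x, hx, e.le_symm_apply.1 hkx⟩

/-- The isomorphism of algebraic frames given by an order isomorphism. -/
def AlgFrm.isoMk {L L' : AlgFrm.{u}} (e : L ≃o L') : L ≅ L' where
  hom := (⟨⟨⟨⟨e, map_inf e⟩, map_top e⟩, map_sSup e⟩,
    fun _ => isCompactElement_map_orderIso e⟩ : AlgFrm.Hom L L')
  inv := (⟨⟨⟨⟨e.symm, map_inf e.symm⟩, map_top e.symm⟩, map_sSup e.symm⟩,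
    fun _ => isCompactElement_map_orderIso e.symm⟩ : AlgFrm.Hom L' L)
  hom_inv_id := AlgFrm.Hom.ext (FrameHom.ext e.symm_apply_apply)
  inv_hom_id := AlgFrm.Hom.ext (FrameHom.ext e.apply_symm_apply)

/-- The isomorphism of distributive meet-semilattices given by an order isomorphism. -/
def DMSP.isoMk {M N : DMSP.{u}} (e : M ≃o N) : M ≅ N where
  hom := (⟨⟨⟨e, map_inf e⟩, map_top e⟩, fun _ _ x hx =>
    ⟨e.symm x, fun s hs => e.le_symm_apply.2 (hx ⟨s, hs, rfl⟩),
      (e.apply_symm_apply x).le⟩⟩ : DMSP.Hom M N)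
  inv := (⟨⟨⟨e.symm, map_inf e.symm⟩, map_top e.symm⟩, fun _ _ x hx =>
    ⟨e x, fun s hs => e.symm_apply_le.1 (hx ⟨s, hs, rfl⟩),
      (e.symm_apply_apply x).le⟩⟩ : DMSP.Hom N M)
  hom_inv_id := DMSP.Hom.ext (InfTopHom.ext e.symm_apply_apply)
  inv_hom_id := DMSP.Hom.ext (InfTopHom.ext e.apply_symm_apply)

section FilterEquivalence

open Order (PFilter)
open Order.PFilter (principal principal_le_principal_iff mem_of_le inf_mem)

/-- The isomorphism between a meet-semilattice and the compact elements of its lattice of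
filters. -/
noncomputable def principalIso (M : Type*) [SemilatticeInf M] [OrderTop M] :
    M ≃o (CompactElements (PFilter M))ᵒᵈ :=
  RelIso.ofSurjective
    (OrderEmbedding.ofMapLEIff
      (fun a : M => (toDual ⟨principal a, isCompactElement_principal a⟩ :
        (CompactElements (PFilter M))ᵒᵈ))
      fun _ _ => principal_le_principal_iff)
    fun k => by
      obtain ⟨a, ha⟩ := isCompactElement_pfilter_iff.1 (ofDual k).2
      exact ⟨a, congrArg toDual (Subtype.ext ha.symm)⟩

variable {L : Type*} [CompleteLattice L]

/-- The filter of `K(L)` consisting of the compact elements below `a`. -/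
def compactsBelow (a : L) : PFilter (CompactElements L)ᵒᵈ :=
  pfilterOfInfClosed {k | (ofDual k).1 ≤ a} ⟨⊤, bot_le (a := a)⟩
    (fun _ hk _ hl => sup_le (α := L) hk hl) (fun _ _ hkl hk => le_trans (α := L) hkl hk)

theorem exists_compactsBelow_eq (F : PFilter (CompactElements L)ᵒᵈ) : ∃ a, compactsBelow a = F := by
  set S : Set L :=
    (fun k : (CompactElements L)ᵒᵈ => (ofDual k).1) '' (F : Set (CompactElements L)ᵒᵈ)
  have hdir : DirectedOn (· ≤ ·) S := by
    rintro _ ⟨k, hk, rfl⟩ _ ⟨l, hl, rfl⟩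
    exact ⟨_, ⟨k ⊓ l, inf_mem hk hl, rfl⟩, le_sup_left (α := L), le_sup_right (α := L)⟩
  refine ⟨sSup S, SetLike.ext fun k => ⟨fun hk => ?_, fun hk => le_sSup ⟨k, hk, rfl⟩⟩⟩
  obtain ⟨_, ⟨l, hl, rfl⟩, hkl⟩ := (ofDual k).2 S _ (F.nonempty.image _) hdir (isLUB_sSup S) hk
  exact mem_of_le (show l ≤ k from hkl) hl

variable [IsCompactlyGenerated L]

theorem compactsBelow_le_compactsBelow {a b : L} : compactsBelow a ≤ compactsBelow b ↔ a ≤ b :=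
  ⟨fun h => le_iff_compact_le_imp.2 fun k hk hka => h (x := toDual ⟨k, hk⟩) hka,
    fun h _ hk => le_trans (α := L) hk h⟩

/-- The isomorphism between an algebraic lattice and the lattice of filters of its compact
elements. -/
noncomputable def compactsBelowIso (L : Type*) [CompleteLattice L] [IsCompactlyGenerated L] :
    L ≃o PFilter (CompactElements L)ᵒᵈ :=
  RelIso.ofSurjective (OrderEmbedding.ofMapLEIff compactsBelow
    fun _ _ => compactsBelow_le_compactsBelow) exists_compactsBelow_eq

theorem AlgFrm.mapFilter_compactsBelow {L L' : AlgFrm.{u}} (f : Hom L L') (a : L) :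
    mapFilter (compactMap f).toInfTopHom (compactsBelow a) = compactsBelow (f.toFrameHom a) := by
  refine SetLike.ext fun k => ⟨?_, fun hk => ?_⟩
  · rintro ⟨l, hl, hlk⟩
    exact le_trans (α := L') hlk (OrderHomClass.mono f.toFrameHom hl)
  · obtain ⟨c, hc, hca, hkc⟩ := exists_isCompactElement_le_map f.toFrameHom (ofDual k).2 hk
    exact ⟨toDual ⟨c, hc⟩, hca, hkc⟩

end FilterEquivalence

/-- The functors `𝓕` and `𝓚` form an equivalence of categories. -/
noncomputable def filterEquivalence : DMSP.{u} ≌ AlgFrm.{u} :=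
  CategoryTheory.Equivalence.mk filterFunctor compactFunctor
    (NatIso.ofComponents (fun M => DMSP.isoMk (N := M.filterFrame.compactDMSP) (principalIso M))
      fun α => DMSP.Hom.ext (InfTopHom.ext fun a => congrArg toDual (Subtype.ext
        (mapFilter_principal (DMSP.Hom.toInfTopHom α) a).symm)))
    (Iso.symm <| NatIso.ofComponents
      (fun L => AlgFrm.isoMk (L' := L.compactDMSP.filterFrame) (compactsBelowIso L))
      fun f => AlgFrm.Hom.ext (FrameHom.ext fun a => (AlgFrm.mapFilter_compactsBelow f a).symm))

theorem isFilterFunctor_filterFunctor : IsFilterFunctor filterFunctor.{u} :=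
  ⟨fun _ => OrderIso.refl _, fun _ _ _ _ => rfl⟩

theorem isCompactElementsFunctor_compactFunctor : IsCompactElementsFunctor compactFunctor.{u} :=
  ⟨fun _ => OrderIso.refl _, fun _ _ _ _ => rfl⟩

/-! ### The duality of frames and spaces -/

theorem IsAdmissibleClopen.preimage_orderIso {X Y : Type u} [TopologicalSpace X] [PartialOrder X]
    [TopologicalSpace Y] [PartialOrder Y] {X₀ : Set X} {Y₀ : Set Y} (e : X ≃o Y)
    (he : Continuous e) (h₀ : e ⁻¹' Y₀ ⊆ X₀) {U : Set Y} (hU : IsAdmissibleClopen Y₀ U) :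
    IsAdmissibleClopen X₀ (e ⁻¹' U) := by
  refine ⟨hU.1.preimage he, hU.2.1.preimage e.monotone, fun x hx => h₀ (hU.2.2 ⟨hx.1, ?_⟩)⟩
  intro y hy hxy
  have hyU : e.symm y ∉ e ⁻¹' U := by rwa [Set.mem_preimage, e.apply_symm_apply]
  exact e.symm_apply_le.1 (hx.2 hyU (e.le_symm_apply.2 hxy))

namespace PGPSP

/-- The isomorphism of pointed generalized Priestley spaces given by an order isomorphism that is a
homeomorphism and matches the distinguished subsets. -/
def isoMk {X Y : PGPSP.{u}} (e : X ≃o Y) (he : IsHomeomorph e) (h₀ : e ⁻¹' Y.X₀ = X.X₀) :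
    X ≅ Y where
  hom := (⟨e, ⟨e.monotone, fun _ hU => hU.preimage_orderIso e he.continuous h₀.subset⟩,
    h₀.superset⟩ : Hom X Y)
  inv := by
    have hcont : Continuous e.symm :=
      (e.toEquiv.toHomeomorphOfIsInducing he.isInducing).symm.continuous
    have h₀symm : e.symm ⁻¹' X.X₀ = Y.X₀ := h₀ ▸ e.symm_preimage_preimage Y.X₀
    exact (⟨e.symm, ⟨e.symm.monotone, fun _ hU =>
      hU.preimage_orderIso e.symm hcont h₀symm.subset⟩, h₀symm.superset⟩ : Hom Y X)
  hom_inv_id := Hom.ext (funext e.symm_apply_apply)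
  inv_hom_id := Hom.ext (funext e.apply_symm_apply)

/-- The algebraic frame of admissible closed upsets. -/
def closedFrame (X : PGPSP.{u}) : AlgFrm.{u} where
  carrier := X.ClosedUpsets

/-- The preimage map of a morphism of spaces, as a morphism of algebraic frames. -/
def comap {X Y : PGPSP.{u}} (f : Hom X Y) : AlgFrm.Hom Y.closedFrame X.closedFrame where
  toFrameHom := ClosedUpsets.comap f
  map_compact _ := ClosedUpsets.isCompactElement_comap f

end PGPSP

/-- The contravariant functor `𝓥ᵃ` from pointed generalized Priestley spaces to algebraic
frames. -/
def admissibleClosedFunctor : PGPSP.{u}ᵒᵖ ⥤ AlgFrm.{u} where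
  obj X := X.unop.closedFrame
  map f := PGPSP.comap f.unop
  map_id _ := rfl
  map_comp _ _ := rfl

/-- The restriction to `Y_L` of the right adjoint of a morphism of algebraic frames, as a morphism
of spaces. -/
def YPoints.spaceMap {L L' : AlgFrm.{u}} (f : AlgFrm.Hom L L') :
    PGPSP.Hom (YPoints.space L') (YPoints.space L) where
  toFun := YPoints.map f.toFrameHom f.map_compact
  strong := YPoints.isStrongPriestley_map f.toFrameHom f.map_compact
  mapsTo _ := infPrime_rightAdjoint f.toFrameHom

/-- The contravariant functor `𝓨` from algebraic frames to pointed generalized Priestley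
spaces. -/
def pseudoprimeFunctor : AlgFrm.{u}ᵒᵖ ⥤ PGPSP.{u} where
  obj L := YPoints.space L.unop
  map f := YPoints.spaceMap f.unop
  map_id _ := PGPSP.Hom.ext (funext fun p => Subtype.ext (rightAdjoint_id p.1))
  map_comp f g := PGPSP.Hom.ext (funext fun p => Subtype.ext (rightAdjoint_comp
    (AlgFrm.Hom.toFrameHom f.unop) (AlgFrm.Hom.toFrameHom g.unop) p.1))

/-- The isomorphism between an algebraic frame and the admissible closed upsets of its space. -/
noncomputable def AlgFrm.upIso (L : AlgFrm.{u}) : L ≃o (YPoints.space L).ClosedUpsets :=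
  RelIso.ofSurjective
    (OrderEmbedding.ofMapLEIff
      (fun a => PGPSP.ClosedUpsets.mk (X := YPoints.space L) (YPoints.up a)
        (YPoints.isAdmissibleClosed_up a))
      fun _ _ => YPoints.up_subset_up)
    fun C => by
      obtain ⟨a, ha⟩ := YPoints.exists_eq_up_of_isAdmissibleClosed C.isAdmissibleClosed_set
      exact ⟨a, PGPSP.ClosedUpsets.ext ha.symm⟩

namespace PGPSP

/-- The order isomorphism between a space and the space of its frame of admissible closed
upsets. -/
noncomputable def pointIso (X : PGPSP.{u}) : X ≃o YPoints X.ClosedUpsets :=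
  RelIso.ofSurjective
    (OrderEmbedding.ofMapLEIff
      (fun x => ⟨ClosedUpsets.point x, ClosedUpsets.isPseudoprime_point_or_eq_top x⟩)
      fun _ _ => ClosedUpsets.point_le_point_iff)
    fun p => by
      obtain ⟨x, hx⟩ := ClosedUpsets.exists_eq_point p.2
      exact ⟨x, Subtype.ext hx.symm⟩

theorem continuous_pointIso (X : PGPSP.{u}) : Continuous X.pointIso :=
  YPoints.continuous_of_isClopen_preimage_up fun C hC => by
    have hpre : X.pointIso ⁻¹' YPoints.up C = C.set :=
      Set.ext fun _ => ClosedUpsets.le_point_iff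
    exact hpre ▸ (ClosedUpsets.isCompactElement_iff.1 hC).1

theorem isHomeomorph_pointIso (X : PGPSP.{u}) : IsHomeomorph X.pointIso :=
  isHomeomorph_iff_continuous_bijective.2 ⟨X.continuous_pointIso, X.pointIso.bijective⟩

end PGPSP

/-- The functors `𝓨` and `𝓥ᵃ` form a dual equivalence of categories. -/
noncomputable def pseudoprimeEquivalence : AlgFrm.{u}ᵒᵖ ≌ PGPSP.{u} :=
  CategoryTheory.Equivalence.mk pseudoprimeFunctor admissibleClosedFunctor.rightOp
    (Iso.symm <| NatIso.ofComponents
      (fun L => (AlgFrm.isoMk (L' := (YPoints.space L.unop).closedFrame) L.unop.upIso).op)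
      fun f => Quiver.Hom.unop_inj <| AlgFrm.Hom.ext <| FrameHom.ext fun a =>
        PGPSP.ClosedUpsets.ext <|
          YPoints.preimage_map_up (AlgFrm.Hom.toFrameHom f.unop) (AlgFrm.Hom.map_compact f.unop) a)
    (Iso.symm <| NatIso.ofComponents
      (fun X => PGPSP.isoMk (Y := YPoints.space X.closedFrame) X.pointIso X.isHomeomorph_pointIso
        (Set.ext fun _ => PGPSP.ClosedUpsets.infPrime_point_iff))
      fun f => PGPSP.Hom.ext <| funext fun x => Subtype.ext
        (PGPSP.ClosedUpsets.rightAdjoint_comap_point f x).symm)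

theorem isPseudoprimeFunctor_pseudoprimeFunctor : IsPseudoprimeFunctor pseudoprimeFunctor.{u} :=
  ⟨fun _ => OrderIso.refl _, fun _ => ⟨(Homeomorph.refl _).isHomeomorph, Set.image_id _⟩,
    fun _ _ _ _ => rfl⟩

theorem isAdmissibleClosedFunctor_admissibleClosedFunctor :
    IsAdmissibleClosedFunctor admissibleClosedFunctor.{u} :=
  ⟨fun _ => OrderIso.refl _, fun _ _ _ _ => rfl⟩

/-! ### The duality of semilattices and spaces -/

/-- The isomorphism between the admissible clopen upsets and the compact elements of the frame of
admissible closed upsets. -/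
def PGPSP.clopenIso (X : PGPSP.{u}) :
    {U : Set X // IsAdmissibleClopen X.X₀ U} ≃o (CompactElements X.ClosedUpsets)ᵒᵈ where
  toFun U := toDual ⟨ClosedUpsets.ofClopen U.1 U.2, ClosedUpsets.isCompactElement_iff.2 U.2⟩
  invFun C := ⟨ClosedUpsets.set (ofDual C).1, ClosedUpsets.isCompactElement_iff.1 (ofDual C).2⟩
  left_inv _ := rfl
  right_inv _ := rfl
  map_rel_iff' := Iff.rfl

theorem isAdmissibleClopenFunctor_admissibleClosedFunctor_comp_compactFunctor :
    IsAdmissibleClopenFunctor (admissibleClosedFunctor.{u} ⋙ compactFunctor) :=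
  ⟨PGPSP.clopenIso, fun _ _ _ _ => rfl⟩

section OptimalFilter

open Order (PFilter)
open Order.PFilter (principal principal_le_iff mem_of_le inf_mem top_mem)

theorem exists_mem_of_finset_sup'_mem {α ι : Type*} [SemilatticeSup α] {P : PFilter α}
    (hP : P.IsPrime) {S : Finset ι} (hS : S.Nonempty) {f : ι → α} (h : S.sup' hS f ∈ P) :
    ∃ a ∈ S, f a ∈ P := by
  by_contra! hno
  have hmem : S.sup' hS f ∈ hP.compl_ideal.toIdeal :=
    Finset.sup'_induction hS f (fun _ ha _ hb => Order.Ideal.sup_mem ha hb) hno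
  exact hmem h

variable {M : Type u} [SemilatticeInf M] [OrderTop M]

theorem isPrimeFilter_iff_infPrime {F : PFilter M} : IsPrimeFilter F ↔ InfPrime F := by
  refine and_congr ?_ (forall₂_congr fun G H => imp_congr ?_ Iff.rfl)
  · rw [isMax_iff_eq_top, pfilter_eq_top_iff]
  · exact ⟨fun h x hx => h (mem_inf_pfilter.1 hx), fun h x hx => h (mem_inf_pfilter.2 hx)⟩

theorem isPseudoprime_or_eq_top_pfilter_iff {F : PFilter M} :
    (IsPseudoprime F ∨ F = ⊤) ↔ ∀ S : Finset M, S.Nonempty → ∀ b ∈ F,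
      S.inf principal ≤ principal b → ∃ a ∈ S, a ∈ F := by
  classical
  rw [isPseudoprime_or_eq_top_iff]
  constructor
  · intro h S hS b hb hSb
    obtain ⟨_, ha, haF⟩ := h (S.image principal) (hS.image _)
      (Finset.forall_mem_image.2 fun a _ => isCompactElement_principal a) (principal b)
      (isCompactElement_principal b) (by rwa [Finset.inf_image]) (principal_le_iff.2 hb)
    obtain ⟨a, haS, rfl⟩ := Finset.mem_image.1 ha
    exact ⟨a, haS, principal_le_iff.1 haF⟩
  · intro h S hS hc k hk hSk hkF
    choose! f hf using fun G hG => isCompactElement_pfilter_iff.1 (hc G hG)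
    obtain ⟨b, rfl⟩ := isCompactElement_pfilter_iff.1 hk
    have hfb : (S.image f).inf principal ≤ principal b := by
      rw [Finset.inf_image]
      exact (Finset.inf_congr rfl fun G hG => (hf G hG).symm).trans_le hSk
    obtain ⟨a, ha, haF⟩ := h (S.image f) (hS.image f) b (principal_le_iff.1 hkF) hfb
    obtain ⟨G, hG, rfl⟩ := Finset.mem_image.1 ha
    exact ⟨G, hG, (hf G hG).trans_le (principal_le_iff.2 haF)⟩

/-- The element `⋃ a ∈ S, primeSet a` of the distributive envelope. -/
def envelopeSup (S : Finset M) : distributiveEnvelope M :=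
  ⟨⋃ a ∈ S, primeSet a, S, S.finite_toSet, rfl⟩

theorem envelopeSup_eq_sup' {S : Finset M} (hS : S.Nonempty) :
    envelopeSup S = S.sup' hS toEnvelope :=
  le_antisymm (Set.iUnion₂_subset fun _ ha => Finset.le_sup' toEnvelope ha)
    (Finset.sup'_le _ _ fun _ ha => Set.subset_biUnion_of_mem (u := primeSet) ha)

theorem envelopeSup_union [DecidableEq M] (S T : Finset M) :
    envelopeSup (S ∪ T) = envelopeSup S ⊔ envelopeSup T :=
  Subtype.ext (Finset.set_biUnion_union S T primeSet)

theorem envelopeSup_singleton (a : M) : envelopeSup {a} = toEnvelope a :=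
  Subtype.ext (Finset.set_biUnion_singleton a primeSet)

theorem toEnvelope_le_envelopeSup {b : M} {S : Finset M}
    (h : S.inf principal ≤ principal b) : toEnvelope b ≤ envelopeSup S := fun P hb => by
  obtain ⟨a, ha, haP⟩ := (InfPrime.finset_inf_le (isPrimeFilter_iff_infPrime.1 P.2)).1
    (h.trans (principal_le_iff.2 hb))
  exact Set.mem_biUnion (Finset.mem_coe.2 ha) (principal_le_iff.1 haP)

theorem IsOptimalFilter.isPseudoprime_or_eq_top {F : PFilter M} (hF : IsOptimalFilter F) :
    IsPseudoprime F ∨ F = ⊤ := by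
  obtain ⟨P, hP, hFP⟩ := hF
  have hmem : ∀ x, x ∈ F ↔ toEnvelope x ∈ P := fun x => Set.ext_iff.1 hFP x
  refine isPseudoprime_or_eq_top_pfilter_iff.2 fun S hS b hb hSb => ?_
  have hSP : envelopeSup S ∈ P := mem_of_le (toEnvelope_le_envelopeSup hSb) ((hmem b).1 hb)
  rw [envelopeSup_eq_sup' hS] at hSP
  obtain ⟨a, ha, haP⟩ := exists_mem_of_finset_sup'_mem hP hS hSP
  exact ⟨a, ha, (hmem a).2 haP⟩

/-- The filter of the distributive envelope generated by a filter of `M`. -/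
def envelopeFilter (F : PFilter M) : PFilter (distributiveEnvelope M) :=
  pfilterOfInfClosed {A | ∃ b ∈ F, toEnvelope b ≤ A} ⟨_, ⊤, top_mem, le_rfl⟩
    (fun _ ⟨a, ha, haA⟩ _ ⟨b, hb, hbB⟩ => ⟨a ⊓ b, inf_mem ha hb,
      (primeSet_inf a b).superset.trans (Set.inter_subset_inter haA hbB)⟩)
    (fun _ _ hAB ⟨b, hb, hbA⟩ => ⟨b, hb, hbA.trans hAB⟩)

/-- The ideal of the distributive envelope generated by the complement of a filter of `M`. -/
def envelopeIdeal (F : PFilter M) : Order.Ideal (distributiveEnvelope M) :=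
  Order.IsIdeal.toIdeal (I := {A | ∃ S : Finset M, (∀ a ∈ S, a ∉ F) ∧ A ≤ envelopeSup S})
    { IsLowerSet := fun _ _ hBA ⟨S, hS, hA⟩ => ⟨S, hS, hBA.trans hA⟩
      Nonempty := ⟨envelopeSup ∅, ∅, fun _ h => absurd h (Finset.notMem_empty _), le_rfl⟩
      Directed := by
        classical
        rintro A ⟨S, hS, hA⟩ B ⟨T, hT, hB⟩
        refine ⟨A ⊔ B, ⟨S ∪ T, fun a ha => ?_, ?_⟩, le_sup_left, le_sup_right⟩
        · exact (Finset.mem_union.1 ha).elim (hS a) (hT a)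
        · exact (sup_le_sup hA hB).trans (envelopeSup_union S T).ge }

namespace DMSP

variable {M : DMSP.{u}} {F : PFilter M}

theorem toEnvelope_le_envelopeSup_iff {b : M} {S : Finset M} :
    toEnvelope b ≤ envelopeSup S ↔ S.inf principal ≤ principal b := by
  refine ⟨fun h => ?_, toEnvelope_le_envelopeSup⟩
  by_contra hle
  obtain ⟨P, hP, hb, hS⟩ := exists_infPrime_of_not_le hle
  have hmem : ⟨P, isPrimeFilter_iff_infPrime.2 hP⟩ ∈ primeSet b := principal_le_iff.1 hb
  obtain ⟨a, ha, haP⟩ := Set.mem_iUnion₂.1 (h hmem)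
  exact hS ((Finset.inf_le ha).trans (principal_le_iff.2 haP))

theorem disjoint_envelopeFilter_envelopeIdeal (hF : IsPseudoprime F) :
    Disjoint (envelopeFilter F : Set (distributiveEnvelope M)) (envelopeIdeal F) := by
  refine Set.disjoint_left.2 ?_
  rintro A ⟨b, hb, hbA⟩ ⟨S, hS, hA⟩
  have hSb := toEnvelope_le_envelopeSup_iff.1 (hbA.trans hA)
  rcases S.eq_empty_or_nonempty with rfl | hne
  · exact hF.1 (top_le_iff.1 (hSb.trans (principal_le_iff.2 hb)))
  · obtain ⟨a, ha, haF⟩ := isPseudoprime_or_eq_top_pfilter_iff.1 (Or.inl hF) S hne b hb hSb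
    exact hS a ha haF

theorem isOptimalFilter_of_isPseudoprime (hF : IsPseudoprime F) : IsOptimalFilter F := by
  obtain ⟨J, hJ, hIJ, hdisj⟩ := DistribLattice.prime_ideal_of_disjoint_filter_ideal
    (disjoint_envelopeFilter_envelopeIdeal hF)
  refine ⟨hJ.toPrimePair.F, hJ.toPrimePair.F_isPrime, Set.ext fun x => ?_⟩
  refine ⟨fun hx => Set.disjoint_left.1 hdisj ⟨x, hx, le_rfl⟩, fun hx => by_contra fun hxF => ?_⟩
  exact hx (hIJ ⟨{x}, by simpa using hxF, (envelopeSup_singleton x).ge⟩)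

theorem isOptimalFilter_or_eq_univ_iff :
    (IsOptimalFilter F ∨ (F : Set M) = Set.univ) ↔ (IsPseudoprime F ∨ F = ⊤) := by
  rw [← pfilter_eq_top_iff]
  exact ⟨fun h => h.elim IsOptimalFilter.isPseudoprime_or_eq_top Or.inr,
    Or.imp_left isOptimalFilter_of_isPseudoprime⟩

/-- The identification of `X_M` with the space of the frame of filters of `M`. -/
def pointsIso (M : DMSP.{u}) : XPoints M ≃o YPoints (PFilter M) where
  toFun F := ⟨F.1, isOptimalFilter_or_eq_univ_iff.1 F.2⟩
  invFun F := ⟨F.1, isOptimalFilter_or_eq_univ_iff.2 F.2⟩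
  left_inv _ := rfl
  right_inv _ := rfl
  map_rel_iff' := Iff.rfl

theorem preimage_pointsIso_up_principal (a : M) :
    M.pointsIso ⁻¹' YPoints.up (principal a) = {G | a ∈ G.1} :=
  Set.ext fun _ => principal_le_iff

theorem continuous_pointsIso (M : DMSP.{u}) : Continuous M.pointsIso := by
  refine YPoints.continuous_of_isClopen_preimage_up fun k hk => ?_
  obtain ⟨a, rfl⟩ := isCompactElement_pfilter_iff.1 hk
  rw [preimage_pointsIso_up_principal]
  exact ⟨⟨TopologicalSpace.isOpen_generateFrom_of_mem (Or.inr ⟨a, rfl⟩)⟩,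
    TopologicalSpace.isOpen_generateFrom_of_mem (Or.inl ⟨a, rfl⟩)⟩

theorem continuous_pointsIso_symm (M : DMSP.{u}) : Continuous M.pointsIso.symm := by
  have hclopen (a : M) : IsClopen (M.pointsIso.symm ⁻¹' {G | a ∈ G.1}) := by
    rw [← preimage_pointsIso_up_principal, M.pointsIso.symm_preimage_preimage]
    exact YPoints.isClopen_up (isCompactElement_principal a)
  refine continuous_generateFrom_iff.2 ?_
  rintro _ (⟨a, rfl⟩ | ⟨a, rfl⟩)
  · exact (hclopen a).isOpen
  · exact (hclopen a).compl.isOpen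

theorem isHomeomorph_pointsIso (M : DMSP.{u}) : IsHomeomorph M.pointsIso :=
  (Homeomorph.mk M.pointsIso.toEquiv M.continuous_pointsIso
    M.continuous_pointsIso_symm).isHomeomorph

theorem image_pointsIso_setOf_isPrimeFilter (M : DMSP.{u}) :
    M.pointsIso '' {G | IsPrimeFilter G.1} = YPoints.primes (PFilter M) := by
  rw [M.pointsIso.image_eq_preimage_symm]
  exact Set.ext fun _ => isPrimeFilter_iff_infPrime

theorem rightAdjoint_mapFilterHom {N : DMSP.{u}} (α : Hom M N) (G : PFilter N) :
    rightAdjoint (mapFilterHom α) G = comapFilter α.toInfTopHom G :=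
  (gc_rightAdjoint (mapFilterHom α)).u_unique (gc_mapFilter_comapFilter α.toInfTopHom)
    fun _ => rfl

end DMSP

theorem isOptimalFilterFunctor_filterFunctor_comp_pseudoprimeFunctor :
    IsOptimalFilterFunctor (filterFunctor.{u}.op ⋙ pseudoprimeFunctor) :=
  ⟨DMSP.pointsIso,
    fun M => ⟨M.isHomeomorph_pointsIso, M.image_pointsIso_setOf_isPrimeFilter⟩,
    fun _ _ α F => congrArg SetLike.coe (DMSP.rightAdjoint_mapFilterHom α F.1)⟩

end OptimalFilter

/-! ### Preservation of finite meets -/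

section FiniteMeets

variable {L₁ L₂ : Type*} [CompleteLattice L₁] [CompleteLattice L₂]

/-- A join-preserving map as a frame homomorphism, given that it preserves the top element and
binary meets. -/
def frameHomOfSSupHom (α : sSupHom L₁ L₂)
    (h : α ⊤ = ⊤ ∧ ∀ a b, α (a ⊓ b) = α a ⊓ α b) : FrameHom L₁ L₂ where
  toFun := α
  map_inf' := h.2
  map_top' := h.1
  map_sSup' := map_sSup α

theorem map_top_and_map_inf_iff_forall_exists_isCompactElement
    [IsCompactlyGenerated L₁] [IsCompactlyGenerated L₂] (α : sSupHom L₁ L₂) :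
    (α ⊤ = ⊤ ∧ ∀ a b : L₁, α (a ⊓ b) = α a ⊓ α b) ↔
      ∀ S : Set L₁, S.Finite → (∀ s ∈ S, IsCompactElement s) →
        ∀ k : L₂, IsCompactElement k → k ≤ sInf (α '' S) →
          ∃ c : L₁, IsCompactElement c ∧ c ≤ sInf S ∧ k ≤ α c := by
  have hmono : Monotone α := OrderHomClass.mono α
  refine ⟨fun h S hS _ k hk hkS => ?_, fun h => ⟨?_, fun a b => ?_⟩⟩
  · obtain ⟨c, hcS, hc, hkc⟩ := exists_isCompactElement_mem_lowerBounds (frameHomOfSSupHom α h) hS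
      hk fun s hs => hkS.trans (sInf_le ⟨s, hs, rfl⟩)
    exact ⟨c, hc, le_sInf hcS, hkc⟩
  · refine top_le_iff.1 (le_iff_compact_le_imp.2 fun k hk _ => ?_)
    obtain ⟨c, -, -, hkc⟩ := h ∅ Set.finite_empty (by simp) k hk (by simp)
    exact hkc.trans (hmono le_top)
  · refine (hmono.map_inf_le a b).antisymm (le_iff_compact_le_imp.2 fun k hk hkab => ?_)
    obtain ⟨s, hs, hsa, hks⟩ := exists_isCompactElement_le_map α hk (le_inf_iff.1 hkab).1
    obtain ⟨t, ht, htb, hkt⟩ := exists_isCompactElement_le_map α hk (le_inf_iff.1 hkab).2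
    obtain ⟨c, -, hc, hkc⟩ := h {s, t} (Set.toFinite _) (by simp [hs, ht]) k hk
      (by simp [Set.image_pair, hks, hkt])
    rw [sInf_pair] at hc
    exact hkc.trans (hmono (hc.trans (inf_le_inf hsa htb)))

end FiniteMeets

theorem map_top_and_map_inf_of_infPrime_rightAdjoint {L₁ L₂ : Type u}
    [CompleteLattice L₁] [Order.Frame L₂] [IsCompactlyGenerated L₂] (α : sSupHom L₁ L₂)
    (h : ∀ p : L₂, InfPrime p → InfPrime (rightAdjoint α p)) :
    α ⊤ = ⊤ ∧ ∀ a b : L₁, α (a ⊓ b) = α a ⊓ α b := by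
  have hgc := gc_rightAdjoint α
  constructor
  · by_contra ht
    obtain ⟨p, hp, hle, -⟩ := exists_infPrime_of_not_le fun hle => ht (top_le_iff.1 hle)
    exact (h p hp).ne_top (top_le_iff.1 ((hgc _ _).1 hle))
  · refine fun a b => le_antisymm (hgc.monotone_l.map_inf_le a b) ?_
    by_contra hab
    obtain ⟨p, hp, hle, hnle⟩ := exists_infPrime_of_not_le hab
    obtain ha | hb := (h p hp).inf_le.1 ((hgc _ _).1 hle)
    · exact hnle (inf_le_left.trans ((hgc _ _).2 ha))
    · exact hnle (inf_le_right.trans ((hgc _ _).2 hb))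

theorem mainTheorem6_general :
    (∃ (E : DMSP.{u} ≌ AlgFrm.{u}) (D : AlgFrm.{u}ᵒᵖ ≌ PGPSP.{u}) (D' : DMSP.{u}ᵒᵖ ≌ PGPSP.{u}),
      IsFilterFunctor E.functor ∧ IsCompactElementsFunctor E.inverse ∧
      IsPseudoprimeFunctor D.functor ∧ IsAdmissibleClosedFunctor D.inverse.leftOp ∧
      IsOptimalFilterFunctor D'.functor ∧ IsAdmissibleClopenFunctor D'.inverse.leftOp ∧
      Nonempty (D'.functor ≅ E.functor.op ⋙ D.functor) ∧
      Nonempty (D'.inverse.leftOp ≅ D.inverse.leftOp ⋙ E.inverse)) ∧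
    ∀ (L₁ L₂ : Type u) [CompleteLattice L₁] [IsCompactlyGenerated L₁]
      [Order.Frame L₂] [IsCompactlyGenerated L₂] (α : sSupHom L₁ L₂),
      (∀ k : L₁, IsCompactElement k → IsCompactElement (α k)) →
      List.TFAE [
        α ⊤ = ⊤ ∧ ∀ a b : L₁, α (a ⊓ b) = α a ⊓ α b,
        ∀ p : L₂, InfPrime p → InfPrime (rightAdjoint α p),
        (∃ h : ∀ p : YPoints L₂, IsPseudoprime (rightAdjoint α p.1) ∨ rightAdjoint α p.1 = ⊤,
          IsStrongPriestley (YPoints.primes L₂) (YPoints.primes L₁)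
            (fun p => (⟨rightAdjoint α p.1, h p⟩ : YPoints L₁))) ∧
          ∀ p : L₂, InfPrime p → InfPrime (rightAdjoint α p),
        ∀ S : Set L₁, S.Finite → (∀ s ∈ S, IsCompactElement s) →
          ∀ k : L₂, IsCompactElement k → k ≤ sInf (α '' S) →
            ∃ c : L₁, IsCompactElement c ∧ c ≤ sInf S ∧ k ≤ α c] := by
  refine ⟨⟨filterEquivalence, pseudoprimeEquivalence,
    filterEquivalence.op.trans pseudoprimeEquivalence,
    isFilterFunctor_filterFunctor, isCompactElementsFunctor_compactFunctor,
    isPseudoprimeFunctor_pseudoprimeFunctor, isAdmissibleClosedFunctor_admissibleClosedFunctor,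
    isOptimalFilterFunctor_filterFunctor_comp_pseudoprimeFunctor,
    isAdmissibleClopenFunctor_admissibleClosedFunctor_comp_compactFunctor,
    ⟨Iso.refl _⟩, ⟨Iso.refl _⟩⟩, fun L₁ L₂ _ _ _ _ α hα => ?_⟩
  tfae_have 1 → 3 := fun h =>
    ⟨⟨fun p => isPseudoprime_rightAdjoint_or_eq_top (frameHomOfSSupHom α h) hα p.2,
      YPoints.isStrongPriestley_map (frameHomOfSSupHom α h) hα⟩,
      fun _ => infPrime_rightAdjoint (frameHomOfSSupHom α h)⟩
  tfae_have 3 → 2 := And.right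
  tfae_have 2 → 1 := map_top_and_map_inf_of_infPrime_rightAdjoint α
  tfae_have 1 ↔ 4 := map_top_and_map_inf_iff_forall_exists_isCompactElement α
  tfae_finish

theorem mainTheorem6 :
    (∃ (E : DMSP.{u} ≌ AlgFrm.{u}) (D : AlgFrm.{u}ᵒᵖ ≌ PGPSP.{u}) (D' : DMSP.{u}ᵒᵖ ≌ PGPSP.{u}),
      IsFilterFunctor E.functor ∧ IsCompactElementsFunctor E.inverse ∧
      IsPseudoprimeFunctor D.functor ∧ IsAdmissibleClosedFunctor D.inverse.leftOp ∧
      IsOptimalFilterFunctor D'.functor ∧ IsAdmissibleClopenFunctor D'.inverse.leftOp ∧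
      Nonempty (D'.functor ≅ E.functor.op ⋙ D.functor) ∧
      Nonempty (D'.inverse.leftOp ≅ D.inverse.leftOp ⋙ E.inverse)) ∧
    ∀ (L₁ L₂ : Type u) [Order.Frame L₁] [IsCompactlyGenerated L₁]
      [Order.Frame L₂] [IsCompactlyGenerated L₂] (α : sSupHom L₁ L₂),
      (∀ k : L₁, IsCompactElement k → IsCompactElement (α k)) →
      List.TFAE [
        α ⊤ = ⊤ ∧ ∀ a b : L₁, α (a ⊓ b) = α a ⊓ α b,
        ∀ p : L₂, InfPrime p → InfPrime (rightAdjoint α p),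
        (∃ h : ∀ p : YPoints L₂, IsPseudoprime (rightAdjoint α p.1) ∨ rightAdjoint α p.1 = ⊤,
          IsStrongPriestley (YPoints.primes L₂) (YPoints.primes L₁)
            (fun p => (⟨rightAdjoint α p.1, h p⟩ : YPoints L₁))) ∧
          ∀ p : L₂, InfPrime p → InfPrime (rightAdjoint α p),
        ∀ S : Set L₁, S.Finite → (∀ s ∈ S, IsCompactElement s) →
          ∀ k : L₂, IsCompactElement k → k ≤ sInf (α '' S) →
            ∃ c : L₁, IsCompactElement c ∧ c ≤ sInf S ∧ k ≤ α c] :=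
  ⟨mainTheorem6_general.1, fun L₁ L₂ => mainTheorem6_general.2 L₁ L₂⟩
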